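/- Let \(\Pi_\infty\) be the improper anisotropic Poisson line process: the Poisson process of non-vertical lines in \(\mathbb{R}^2\) whose intensity measure, when a line is parametrized by its intercepts \(y_-,y_+\) on the axes \(x=-1\), \(x=1\), is \(\tfrac14\,dy_-\,dy_+\). Let \(\Pi_{\infty,+}\) be the set of those lines of \(\Pi_\infty\) that have positive slope and meet the negative \(x\)-axis, and for \(s\in(0,1]\) let \(\Gamma(s)\) be the infimum of the heights at which the lines of \(\Pi_{\infty,+}\) meet the vertical axis at abscissa \(s\). Let \(\Gamma'\) denote the left derivative of \(\Gamma\). Put \(S_0=1\), let \(S_1>S_2>\cdots\) be the successive points of \((0,1)\), taken in decreasing order, at which \(\Gamma\) changes slope (that is, is not differentiable), and put \(Y_n=\Gamma(S_n)-S_n\Gamma'(S_n)\). Then almost surely \(1=S_0>S_1>S_2>\cdots>0\) and \(Y_n>0\) for all \(n\ge 0\); and there is an absolute constant \(C\) such that for every \(n\geq 0\) the random variable \(Y_n^3/S_n\) is integrable with \[ \mathbb{E}\left[\frac{Y_n^3}{S_n}\right]\;\leq\; C\cdot 3^{-n}. \] In particular, \(Y_n^3/S_n\) almost surely converges to zero geometrically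 fast: for every \(\rho\in(\tfrac13,1)\), almost surely there is a finite (random) \(K\) with \(Y_n^3/S_n\le K\rho^n\) for all \(n\geq 0\). -/

import Mathlib

open MeasureTheory ProbabilityTheory Set

universe u

noncomputable section

namespace PoissonCity

/-- `X` is (a version of) a Poisson point process with intensity measure `ν`, viewed as a random
set of points: the number of points in a Borel set of finite intensity is Poisson distributed, and
the numbers of points in disjoint Borel sets are independent. -/
structure IsPoissonProcess {E Ω : Type*} [MeasurableSpace E] [MeasurableSpace Ω]
    (ν : Measure E) (X : Ω → Set E) (P : Measure Ω) : Prop where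
  measurable_count : ∀ A : Set E, MeasurableSet A → Measurable fun ω => (X ω ∩ A).encard
  law_count : ∀ A : Set E, MeasurableSet A → ν A ≠ ⊤ → ∀ k : ℕ,
    P {ω | (X ω ∩ A).encard = k} = poissonMeasure (ν A).toNNReal {k}
  indep_count : ∀ (m : ℕ) (A : Fin m → Set E), (∀ i, MeasurableSet (A i)) →
    Pairwise (fun i j => Disjoint (A i) (A j)) →
    iIndepFun (fun i ω => (X ω ∩ A i).encard) P

/-- A non-vertical line of the plane, parametrized by the pair `(y₋, y₊)` of its intercepts on the
vertical axes `x = -1` and `x = 1`. -/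
abbrev Line : Type := ℝ × ℝ

/-- The height `y` at which the line meets the vertical axis at abscissa `x`. -/
def height (l : Line) (x : ℝ) : ℝ := (1 - x) / 2 * l.1 + (1 + x) / 2 * l.2

/-- The slope of the line. -/
def slope (l : Line) : ℝ := (l.2 - l.1) / 2

/-- The intensity measure `dν = dy₋ dy₊ / 4` of the improper anisotropic Poisson line process. -/
def improperIntensity : Measure Line := (4 : ENNReal)⁻¹ • volume

/-- The lines of `L` of positive slope which meet the negative part of the `x`-axis. -/
def positiveLines (L : Set Line) : Set Line :=
  {l ∈ L | 0 < slope l ∧ ∃ x < 0, height l x = 0}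

/-- The (right) seminal curve `Γ = Γ₊`: the lower envelope of the lines in `positiveLines L`.
Only its values at `s ∈ (0, 1]` are used. -/
def seminalCurve (L : Set Line) (s : ℝ) : ℝ := sInf ((fun l => height l s) '' positiveLines L)

/-- The derivative `Γ'` of the seminal curve, in its left-continuous version (left derivative). -/
def seminalSlope (L : Set Line) (s : ℝ) : ℝ := derivWithin (seminalCurve L) (Iio s) s

/-- The times `1 = S₀ > S₁ > S₂ > …` of changes of slope of `Γ` on `(0, 1]`, in reversed time. -/
def changeTime (L : Set Line) : ℕ → ℝ
  | 0 => 1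
  | n + 1 => sSup {s ∈ Ioo 0 (changeTime L n) | ¬ DifferentiableAt ℝ (seminalCurve L) s}

/-- `Yₙ = Γ(Sₙ) - Sₙ Γ'(Sₙ)`, the intercept on the `y`-axis of the line followed by `Γ` on
`(Sₙ₊₁, Sₙ]`. -/
def yIntercept (L : Set Line) (n : ℕ) : ℝ :=
  seminalCurve L (changeTime L n) - changeTime L n * seminalSlope L (changeTime L n)

end PoissonCity

end

noncomputable section

namespace PoissonCity

open scoped ENNReal Topology

/-! Record each line by `(y, m)`, its intercept on the `y`-axis and its slope. The lines that define
`Γ` become a Poisson process on the open positive quadrant with intensity `dy dm / 2`, and the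
height at `s = 1 / t` is `y + s m = s (t y + m)`. Hence lowering `s` from `1` amounts to raising `t`
from `1` and following the minimiser of `t y + m` along the lower left hull of the points. The
changes of slope are the times `Tₙ = 1 / Sₙ` at which the minimiser moves to a point `(Yₙ, Mₙ)` with
smaller `y`, and the quotient to bound is `Yₙ³ Tₙ`.

The core is an exact one-step identity (`lintegral_step`), obtained from the Mecke formula
(`lintegral_mecke`). A point `x = (y, m)` inserted into the configuration becomes vertex `n + 1`
when `y < Yₙ` and the time `t` at which it is level with vertex `n` falls between `Tₙ` and `Tₙ₊₁`.
Substituting `t` for `m`, so that `dm = (Yₙ - y) dt`, gives `E[b(Yₙ) d(Yₙ₊₁) c(Tₙ₊₁)] = E[b(Yₙ) · ½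
∫₀^{Yₙ} (Yₙ - y) d(y) dy · ∫_{Tₙ}^{Tₙ₊₁} c(t) dt]`.

With powers for `b` and `d`, passing from `Yₙ` to `Yₙ₊₁` multiplies the `k`-th moment, weighted by
`c(Tₙ₊₁)`, by `2 / ((k + 1) (k + 2))`: this is `1/3` for `k = 1` and `1/10` for `k = 3`. With `b(y)
= y` and `c = d = 1` it gives `E[Yₙ³ (Tₙ₊₁ - Tₙ)] = 4 E[Yₙ]`. Therefore `E[Yₙ₊₁³ Tₙ₊₁] = (E[Yₙ³ Tₙ]
+ 4 E[Yₙ]) / 10` with `E[Yₙ] = 3⁻ⁿ E[Y₀]`, and the slower rate `1/3` prevails. An empty-square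
estimate bounds `E[Y₀³]`. The almost sure statement follows by summing `ρ⁻ⁿ E[Yₙ³ Tₙ]`. -/

/-! ### The void-event σ-algebra on configurations -/

/-- Sets of points of `E`, with the σ-algebra generated by the void events. -/
def Config (E : Type*) : Type _ := Set E

/-- The points of a configuration. -/
abbrev Config.points {E : Type*} (X : Config E) : Set E := X

/-- A set of points, viewed as a configuration. -/
def Config.ofSet {E : Type*} (S : Set E) : Config E := S

/-- The event that a configuration has no point in `V`. -/
def voidEvent {E : Type*} (V : Set E) : Set (Config E) := {X | X.points ∩ V = ∅}

/-- The void events of measurable sets. -/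
def voidEvents (E : Type*) [MeasurableSpace E] : Set (Set (Config E)) :=
  {G | ∃ V : Set E, MeasurableSet V ∧ G = voidEvent V}

instance instMeasurableSpaceConfig (E : Type*) [MeasurableSpace E] : MeasurableSpace (Config E) :=
  MeasurableSpace.generateFrom (voidEvents E)

section Config

variable {E : Type*} [MeasurableSpace E]

lemma measurableSet_voidEvent {V : Set E} (hV : MeasurableSet V) :
    MeasurableSet (voidEvent V) :=
  MeasurableSpace.measurableSet_generateFrom ⟨V, hV, rfl⟩

lemma isPiSystem_voidEvents : IsPiSystem (voidEvents E) := by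
  rintro _ ⟨V, hV, rfl⟩ _ ⟨W, hW, rfl⟩ -
  refine ⟨V ∪ W, hV.union hW, ?_⟩
  ext X
  change X.points ∩ V = ∅ ∧ X.points ∩ W = ∅ ↔ X.points ∩ (V ∪ W) = ∅
  rw [inter_union_distrib_left, union_empty_iff]

lemma univ_mem_voidEvents : univ ∈ voidEvents E :=
  ⟨∅, MeasurableSet.empty, by ext X; exact ⟨fun _ => inter_empty X.points, fun _ => trivial⟩⟩

lemma measurable_config {α : Type*} [MeasurableSpace α] {f : α → Config E}
    (hf : ∀ V : Set E, MeasurableSet V → MeasurableSet (f ⁻¹' voidEvent V)) : Measurable f := by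
  refine measurable_generateFrom ?_
  rintro _ ⟨V, hV, rfl⟩
  exact hf V hV

/-- Deleting `x` empties `V` exactly when `S ∩ V ⊆ {x}`, so the preimage of a void event is
everything, one point, or nothing. -/
lemma measurable_diff_singleton [MeasurableSingletonClass E] (S : Set E) :
    Measurable fun x : E => Config.ofSet (S \ {x}) := by
  refine measurable_config fun V _ => ?_
  have : (fun x : E => Config.ofSet (S \ {x})) ⁻¹' voidEvent V = {x | S ∩ V ⊆ {x}} := by
    ext x
    change (S \ {x}) ∩ V = ∅ ↔ S ∩ V ⊆ {x}
    rw [← sdiff_eq_empty, sdiff_inter_right_comm]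
  rw [this]
  rcases (S ∩ V).eq_empty_or_nonempty with h | ⟨v, hv⟩
  · simp [h]
  · refine Set.Subsingleton.measurableSet fun x hx y hy => ?_
    have h1 : v = x := hx hv
    have h2 : v = y := hy hv
    rw [← h1, h2]

end Config

/-! ### Means and void probabilities of Poisson counts -/

lemma lintegral_natCast_poissonMeasure (r : NNReal) :
    ∫⁻ n : ℕ, (n : ℝ≥0∞) ∂poissonMeasure r = r := by
  rw [lintegral_countable', tsum_eq_zero_add' ENNReal.summable]
  simp only [CharP.cast_eq_zero, zero_mul, zero_add]
  have h : ∀ n : ℕ, ((n + 1 : ℕ) : ℝ≥0∞) * poissonMeasure r {n + 1}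
      = r * poissonMeasure r {n} := by
    intro n
    rw [poissonMeasure_singleton, poissonMeasure_singleton, ← ENNReal.ofReal_natCast,
      ← ENNReal.ofReal_coe_nnreal, ← ENNReal.ofReal_mul (by positivity),
      ← ENNReal.ofReal_mul (by positivity)]
    congr 1
    rw [Nat.factorial_succ]
    push_cast
    have : (n.factorial : ℝ) ≠ 0 := by positivity
    have : (n : ℝ) + 1 ≠ 0 := by positivity
    field_simp
    ring
  simp_rw [h]
  rw [ENNReal.tsum_mul_left]
  have : ∑' n : ℕ, poissonMeasure r {n} = 1 := by
    have := lintegral_countable' (μ := poissonMeasure r) (fun _ => 1)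
    simpa using this.symm
  rw [this, mul_one]

namespace IsPoissonProcess

variable {E Ω : Type*} [MeasurableSpace E] [MeasurableSpace Ω] {ν : Measure E} {X : Ω → Set E}
  {P : Measure Ω}

lemma measurable_config (h : IsPoissonProcess ν X P) : Measurable fun ω => Config.ofSet (X ω) := by
  refine PoissonCity.measurable_config fun V hV => ?_
  have : (fun ω => Config.ofSet (X ω)) ⁻¹' voidEvent V = (fun ω => (X ω ∩ V).encard) ⁻¹' {0} := by
    ext ω
    change X ω ∩ V = ∅ ↔ (X ω ∩ V).encard = 0
    rw [encard_eq_zero]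
  rw [this]
  exact h.measurable_count V hV (MeasurableSet.singleton _)

lemma ae_finite [IsProbabilityMeasure P] (h : IsPoissonProcess ν X P) {A : Set E}
    (hA : MeasurableSet A) (hν : ν A ≠ ∞) :
    ∀ᵐ ω ∂P, (X ω ∩ A).Finite := by
  have hm := h.measurable_count A hA
  have h1 : P (⋃ k : ℕ, {ω | (X ω ∩ A).encard = k}) = 1 := by
    rw [measure_iUnion]
    · simp_rw [h.law_count A hA hν]
      have := lintegral_countable' (μ := poissonMeasure (ν A).toNNReal) (fun _ => 1)
      simpa using this.symm
    · intro i j hij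
      refine Set.disjoint_left.2 fun ω h1 h2 => hij ?_
      have h1 : (X ω ∩ A).encard = i := h1
      have h2 : (X ω ∩ A).encard = j := h2
      exact_mod_cast h1.symm.trans h2
    · exact fun k => hm (MeasurableSet.singleton _)
  have h2 : MeasurableSet (⋃ k : ℕ, {ω | (X ω ∩ A).encard = k}) :=
    MeasurableSet.iUnion fun k => hm (MeasurableSet.singleton _)
  filter_upwards [(mem_ae_iff_prob_eq_one h2).2 h1] with ω hω
  obtain ⟨k, hk⟩ := mem_iUnion.1 hω
  exact finite_of_encard_eq_coe hk

lemma lintegral_count [IsProbabilityMeasure P] (h : IsPoissonProcess ν X P) {A : Set E}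
    (hA : MeasurableSet A) (hν : ν A ≠ ∞) : ∫⁻ ω, ((X ω ∩ A).encard : ℝ≥0∞) ∂P = ν A := by
  have hm := h.measurable_count A hA
  have hN : Measurable fun ω => (X ω ∩ A).encard.toNat := Measurable.of_discrete.comp hm
  have hmap : P.map (fun ω => (X ω ∩ A).encard.toNat) = poissonMeasure (ν A).toNNReal := by
    refine Measure.ext_of_singleton fun k => ?_
    rw [Measure.map_apply hN (MeasurableSet.singleton _), ← h.law_count A hA hν k]
    refine measure_congr ?_
    filter_upwards [h.ae_finite hA hν] with ω hω
    refine propext ?_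
    change (X ω ∩ A).encard.toNat = k ↔ (X ω ∩ A).encard = k
    rw [← hω.cast_ncard_eq]
    simp
  have h2 : ∫⁻ ω, ((X ω ∩ A).encard : ℝ≥0∞) ∂P
      = ∫⁻ ω, (((X ω ∩ A).encard.toNat : ℕ) : ℝ≥0∞) ∂P := by
    refine lintegral_congr_ae ?_
    filter_upwards [h.ae_finite hA hν] with ω hω
    rw [← hω.cast_ncard_eq]
    simp
  rw [h2, ← lintegral_map (f := fun n : ℕ => (n : ℝ≥0∞)) Measurable.of_discrete hN, hmap,
    lintegral_natCast_poissonMeasure, ENNReal.coe_toNNReal hν]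

lemma indepFun_count (h : IsPoissonProcess ν X P) {A B : Set E} (hA : MeasurableSet A)
    (hB : MeasurableSet B) (hAB : Disjoint A B) :
    IndepFun (fun ω => (X ω ∩ A).encard) (fun ω => (X ω ∩ B).encard) P := by
  have := h.indep_count 2 ![A, B] (by simp [Fin.forall_fin_two, hA, hB])
    (by
      intro i j hij
      fin_cases i <;> fin_cases j <;> simp_all [disjoint_comm])
  exact this.indepFun (i := 0) (j := 1) (by simp)

/-- `λ e^{-λ}` is `λ` times `e^{-λ}`. This identity turns "the only point of the set is the marked
one" into "the set is empty, then a point is inserted", which is the Mecke formula in miniature. -/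
lemma measure_count_eq_one (h : IsPoissonProcess ν X P) {A : Set E} (hA : MeasurableSet A)
    (hν : ν A ≠ ∞) :
    P {ω | (X ω ∩ A).encard = 1} = ν A * P {ω | (X ω ∩ A).encard = 0} := by
  have h1 := h.law_count A hA hν 1
  have h0 := h.law_count A hA hν 0
  rw [poissonMeasure_singleton] at h0 h1
  push_cast at h0 h1
  rw [h0, h1]
  nth_rw 3 [← ENNReal.coe_toNNReal hν]
  rw [← ENNReal.ofReal_coe_nnreal, ← ENNReal.ofReal_mul (by positivity)]
  congr 1
  simp [mul_comm]
  rfl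

lemma measure_void (h : IsPoissonProcess ν X P) {A : Set E} (hA : MeasurableSet A)
    (hν : ν A ≠ ∞) :
    P {ω | X ω ∩ A = ∅} = ENNReal.ofReal (Real.exp (-(ν A).toReal)) := by
  have h0 := h.law_count A hA hν 0
  rw [poissonMeasure_singleton] at h0
  simp only [Nat.cast_zero, encard_eq_zero] at h0
  rw [h0]
  simp [ENNReal.toReal]

end IsPoissonProcess

/-! ### The Mecke formula -/

open Classical in
/-- The sum of Dirac masses at the pairs `(x, S \ {x})`, where `x` runs over the points of the
finite set `S ∩ A` (and zero if that set is infinite). -/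
def reducedMeasure {E : Type*} [MeasurableSpace E] (A S : Set E) : Measure (E × Config E) :=
  if (S ∩ A).Finite then
    (Measure.count.restrict (S ∩ A)).map fun x => (x, Config.ofSet (S \ {x}))
  else 0

lemma encard_inter_add_diff {E : Type*} (S C V : Set E) (h : C ⊆ V) :
    (S ∩ V).encard = (S ∩ C).encard + (S ∩ (V \ C)).encard := by
  rw [← encard_union_eq]
  · rw [← inter_union_distrib_left, union_sdiff_cancel h]
  · exact (disjoint_sdiff_right).mono inter_subset_right inter_subset_right

section Reduced

variable {E : Type*} [MeasurableSpace E] [MeasurableSingletonClass E]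

lemma measurable_pair_diff (S : Set E) :
    Measurable fun x : E => (x, Config.ofSet (S \ {x})) :=
  measurable_id.prodMk (measurable_diff_singleton S)

instance (A S : Set E) : IsFiniteMeasure (reducedMeasure A S) := by
  unfold reducedMeasure
  split_ifs with h
  · refine ⟨?_⟩
    rw [Measure.map_apply (measurable_pair_diff S) MeasurableSet.univ, preimage_univ,
      Measure.restrict_apply_univ]
    exact Measure.count_apply_lt_top.2 h
  · infer_instance

/-- A marked point whose removal leaves `V` empty lies either outside `V`, with `V` already empty,
or in `V` as its only point. Each case is expressed by counts in disjoint sets, to which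
independence applies. -/
lemma reducedMeasure_prod_voidEvent {A S B V : Set E} (hS : (S ∩ A).Finite)
    (hB : MeasurableSet B) (hV : MeasurableSet V) :
    reducedMeasure A S (B ×ˢ voidEvent V) =
      (if (S ∩ V).encard = 0 then 1 else 0) * ((S ∩ ((A ∩ B) \ V)).encard : ℝ≥0∞)
      + (if (S ∩ (A ∩ B ∩ V)).encard = 1 then 1 else 0)
        * (if (S ∩ (V \ (A ∩ B ∩ V))).encard = 0 then 1 else 0) := by
  have hm := measurable_pair_diff S
  have hR := hB.prod (measurableSet_voidEvent hV)
  rw [reducedMeasure, if_pos hS, Measure.map_apply hm hR, Measure.restrict_apply (hm hR),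
    Measure.count_apply ((hm hR).inter hS.measurableSet)]
  have hset : ((fun x : E => (x, Config.ofSet (S \ {x}))) ⁻¹' B ×ˢ voidEvent V) ∩ (S ∩ A)
      = {x | x ∈ S ∧ x ∈ A ∧ x ∈ B ∧ S ∩ V ⊆ {x}} := by
    ext x
    have : (Config.ofSet (S \ {x}) ∈ voidEvent V) ↔ S ∩ V ⊆ {x} := by
      change (S \ {x}) ∩ V = ∅ ↔ S ∩ V ⊆ {x}
      rw [← sdiff_eq_empty, sdiff_inter_right_comm]
    simp only [mem_inter_iff, mem_preimage, mem_prod, this, mem_ofPred_eq]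
    tauto
  rw [hset]
  have hadd := encard_inter_add_diff S (A ∩ B ∩ V) V inter_subset_right
  rcases (S ∩ V).eq_empty_or_nonempty with h0 | ⟨v, hv⟩
  · have e1 : {x | x ∈ S ∧ x ∈ A ∧ x ∈ B ∧ S ∩ V ⊆ {x}} = S ∩ ((A ∩ B) \ V) := by
      ext x
      have : x ∈ S → x ∉ V := fun h1 h2 => by
        have : x ∈ S ∩ V := ⟨h1, h2⟩
        rw [h0] at this
        exact this
      simp only [h0, empty_subset, mem_ofPred_eq, mem_inter_iff, mem_sdiff]
      tauto
    have e2 : (S ∩ (A ∩ B ∩ V)).encard = 0 := by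
      rw [encard_eq_zero, ← subset_empty_iff, ← h0]
      exact fun x hx => ⟨hx.1, hx.2.2⟩
    rw [e1, e2, h0]
    simp
  · have hne : (S ∩ V).encard ≠ 0 := by
      rw [Ne, encard_eq_zero]
      exact Nonempty.ne_empty ⟨v, hv⟩
    rw [if_neg hne, zero_mul, zero_add]
    by_cases hs : S ∩ V ⊆ {v}
    · have hVv : S ∩ V = {v} := Subset.antisymm hs (singleton_subset_iff.2 hv)
      rw [hVv, encard_singleton] at hadd
      have e1 : {x | x ∈ S ∧ x ∈ A ∧ x ∈ B ∧ S ∩ V ⊆ {x}} = S ∩ (A ∩ B ∩ V) := by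
        ext x
        simp only [hVv, singleton_subset_iff, mem_singleton_iff, mem_ofPred_eq, mem_inter_iff]
        constructor
        · rintro ⟨h1, h2, h3, rfl⟩
          exact ⟨h1, ⟨h2, h3⟩, hv.2⟩
        · rintro ⟨h1, ⟨h2, h3⟩, h4⟩
          have : x ∈ S ∩ V := ⟨h1, h4⟩
          rw [hVv] at this
          exact ⟨h1, h2, h3, this.symm⟩
      rw [e1]
      by_cases hc : (S ∩ (A ∩ B ∩ V)).encard = 1
      · have : (S ∩ (V \ (A ∩ B ∩ V))).encard = 0 := by
          rw [hc] at hadd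
          generalize (S ∩ (V \ (A ∩ B ∩ V))).encard = n at hadd ⊢
          cases n using ENat.recTopCoe with
          | top => simp at hadd
          | coe n =>
            norm_cast at hadd ⊢
            omega
        rw [hc, this]
        simp
      · have hle : (S ∩ (A ∩ B ∩ V)).encard ≤ 1 := by
          rw [hadd]; exact le_self_add
        have : (S ∩ (A ∩ B ∩ V)).encard = 0 :=
          Order.lt_one_iff.1 (lt_of_le_of_ne hle hc)
        simp [this]
    · have e1 : {x | x ∈ S ∧ x ∈ A ∧ x ∈ B ∧ S ∩ V ⊆ {x}} = ∅ := by
        refine eq_empty_of_forall_notMem fun x hx => hs ?_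
        have : v = x := hx.2.2.2 hv
        rw [this]
        exact hx.2.2.2
      rw [e1]
      by_cases hc : (S ∩ (A ∩ B ∩ V)).encard = 1
      · have : (S ∩ (V \ (A ∩ B ∩ V))).encard ≠ 0 := by
          intro h0
          rw [hc, h0, add_zero] at hadd
          obtain ⟨w, hw⟩ := encard_eq_one.1 hadd
          have : v = w := by rw [hw] at hv; exact hv
          exact hs (by rw [hw, this])
        rw [if_neg this]
        simp
      · simp [hc]

end Reduced

namespace IsPoissonProcess

variable {E Ω : Type*} [MeasurableSpace E] [MeasurableSingletonClass E] [MeasurableSpace Ω]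
  {ν : Measure E} {X : Ω → Set E} {P : Measure Ω}

/-- Products of measurable sets with void events form a generating π-system, and there the mass is a
function of finitely many counts. -/
lemma measurable_reducedMeasure (h : IsPoissonProcess ν X P) {A : Set E} (hA : MeasurableSet A) :
    Measurable fun ω => reducedMeasure A (X ω) := by
  have hcs : IsCountablySpanning {s : Set E | MeasurableSet s} := isCountablySpanning_measurableSet
  have hcs' : IsCountablySpanning (voidEvents E) :=
    ⟨fun _ => univ, fun _ => univ_mem_voidEvents, iUnion_const _⟩
  have hbasic : ∀ B : Set E, MeasurableSet B → ∀ V : Set E, MeasurableSet V →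
      Measurable fun ω => reducedMeasure A (X ω) (B ×ˢ voidEvent V) := by
    intro B hB V hV
    have hfin : MeasurableSet {ω | (X ω ∩ A).Finite} := by
      have := h.measurable_count A hA (MeasurableSet.of_discrete (s := {⊤}ᶜ))
      convert! this using 1
      ext ω
      simp [encard_eq_top_iff]
    have : (fun ω => reducedMeasure A (X ω) (B ×ˢ voidEvent V)) =
        {ω | (X ω ∩ A).Finite}.indicator fun ω =>
      (if (X ω ∩ V).encard = 0 then 1 else 0) * ((X ω ∩ ((A ∩ B) \ V)).encard : ℝ≥0∞)
      + (if (X ω ∩ (A ∩ B ∩ V)).encard = 1 then 1 else 0)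
        * (if (X ω ∩ (V \ (A ∩ B ∩ V))).encard = 0 then 1 else 0) := by
      funext ω
      by_cases hω : (X ω ∩ A).Finite
      · rw [indicator_of_mem (by exact hω), reducedMeasure_prod_voidEvent hω hB hV]
      · rw [indicator_of_notMem (by exact hω), reducedMeasure, if_neg hω]
        rfl
    rw [this]
    have d : ∀ {f : ℕ∞ → ℝ≥0∞} {C : Set E}, MeasurableSet C →
        Measurable fun ω => f (X ω ∩ C).encard := fun hC =>
      (Measurable.of_discrete).comp (h.measurable_count _ hC)
    refine Measurable.indicator ?_ hfin
    exact ((d (f := fun n => if n = 0 then 1 else 0) hV).mul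
      (d (f := fun n => (n : ℝ≥0∞)) ((hA.inter hB).diff hV))).add
      ((d (f := fun n => if n = 1 then 1 else 0) ((hA.inter hB).inter hV)).mul
      (d (f := fun n => if n = 0 then 1 else 0) (hV.diff ((hA.inter hB).inter hV))))
  refine Measurable.measure_of_isPiSystem
    (generateFrom_eq_prod MeasurableSpace.generateFrom_measurableSet rfl hcs hcs').symm
    (MeasurableSpace.isPiSystem_measurableSet.prod isPiSystem_voidEvents) ?_ ?_
  · rintro _ ⟨B, hB, _, ⟨V, hV, rfl⟩, rfl⟩
    exact hbasic B hB V hV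
  · have := hbasic univ MeasurableSet.univ ∅ MeasurableSet.empty
    have e : voidEvent (∅ : Set E) = univ := by
      ext X; exact ⟨fun _ => trivial, fun _ => inter_empty X.points⟩
    rwa [e, univ_prod_univ] at this

variable [IsProbabilityMeasure P]

/-- Two finite measures are compared on a generating π-system. The two cases of
`reducedMeasure_prod_voidEvent` contribute `ν ((A ∩ B) \ V)` and `ν (A ∩ B ∩ V)`, each times the
void probability of `V`. -/
lemma bind_reducedMeasure (h : IsPoissonProcess ν X P) {A : Set E}
    (hA : MeasurableSet A) (hν : ν A ≠ ∞) :
    P.bind (fun ω => reducedMeasure A (X ω))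
      = (ν.restrict A).prod (P.map fun ω => Config.ofSet (X ω)) := by
  have hX := h.measurable_config
  have : IsProbabilityMeasure (P.map fun ω => Config.ofSet (X ω)) :=
    Measure.isProbabilityMeasure_map hX.aemeasurable
  have : IsFiniteMeasure (ν.restrict A) := ⟨by simpa using hν.lt_top⟩
  refine (Measure.prod_eq_generateFrom (C := {s : Set E | MeasurableSet s}) (D := voidEvents E)
    MeasurableSpace.generateFrom_measurableSet rfl
    MeasurableSpace.isPiSystem_measurableSet isPiSystem_voidEvents
    ⟨fun _ => univ, fun _ => MeasurableSet.univ, fun _ => measure_lt_top _ _, iUnion_const _⟩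
    ⟨fun _ => univ, fun _ => univ_mem_voidEvents, fun _ => measure_lt_top _ _, iUnion_const _⟩
    ?_).symm
  rintro B hB _ ⟨V, hV, rfl⟩
  have hB : MeasurableSet B := hB
  have hC := (hA.inter hB).inter hV
  have hCA : ν (A ∩ B ∩ V) ≠ ∞ := measure_ne_top_of_subset (fun x hx => hx.1.1) hν
  have hDA : ν ((A ∩ B) \ V) ≠ ∞ := measure_ne_top_of_subset (fun x hx => hx.1.1) hν
  rw [Measure.bind_apply (hB.prod (measurableSet_voidEvent hV))
    (h.measurable_reducedMeasure hA).aemeasurable, Measure.restrict_apply hB,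
    Measure.map_apply hX (measurableSet_voidEvent hV)]
  have d : ∀ {f : ℕ∞ → ℝ≥0∞} {C : Set E}, MeasurableSet C →
        Measurable fun ω => f (X ω ∩ C).encard := fun hC =>
      (Measurable.of_discrete).comp (h.measurable_count _ hC)
  have hind : ∀ (k : ℕ∞) {C : Set E}, MeasurableSet C →
      ∫⁻ ω, (if (X ω ∩ C).encard = k then 1 else 0) ∂P = P {ω | (X ω ∩ C).encard = k} := by
    intro k C hC
    have := lintegral_indicator_one (μ := P) (h.measurable_count C hC (MeasurableSet.singleton k))
    rw [show {ω | (X ω ∩ C).encard = k} = (fun ω => (X ω ∩ C).encard) ⁻¹' {k} from rfl, ← this]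
    refine lintegral_congr fun ω => ?_
    simp [indicator]
  have hvoid : (fun ω => Config.ofSet (X ω)) ⁻¹' voidEvent V = {ω | (X ω ∩ V).encard = 0} := by
    ext ω
    change X ω ∩ V = ∅ ↔ (X ω ∩ V).encard = 0
    rw [encard_eq_zero]
  have hprod : P {ω | (X ω ∩ V).encard = 0} = P {ω | (X ω ∩ (A ∩ B ∩ V)).encard = 0} *
      P {ω | (X ω ∩ (V \ (A ∩ B ∩ V))).encard = 0} := by
    have := (h.indepFun_count hC (hV.diff hC) disjoint_sdiff_right).measure_inter_preimage_eq_mul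
      {0} {0} (MeasurableSet.singleton _) (MeasurableSet.singleton _)
    change _ = P {ω | (X ω ∩ (A ∩ B ∩ V)).encard = 0} *
      P {ω | (X ω ∩ (V \ (A ∩ B ∩ V))).encard = 0} at this
    rw [← this]
    congr 1
    ext ω
    have := encard_inter_add_diff (X ω) (A ∩ B ∩ V) V inter_subset_right
    simp only [mem_ofPred_eq, mem_inter_iff, mem_preimage, mem_singleton_iff]
    rw [this, add_eq_zero]
  have i1 : ∫⁻ ω, (if (X ω ∩ V).encard = 0 then 1 else 0) *
      ((X ω ∩ ((A ∩ B) \ V)).encard : ℝ≥0∞) ∂P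
      = P {ω | (X ω ∩ V).encard = 0} * ν ((A ∩ B) \ V) := by
    rw [← hind 0 hV, ← h.lintegral_count ((hA.inter hB).diff hV) hDA]
    exact lintegral_mul_eq_lintegral_mul_lintegral_of_indepFun
      (d (f := fun n => if n = 0 then 1 else 0) hV)
      (d (f := fun n => (n : ℝ≥0∞)) ((hA.inter hB).diff hV))
      ((h.indepFun_count hV ((hA.inter hB).diff hV) disjoint_sdiff_right).comp
        (φ := fun n : ℕ∞ => if n = 0 then (1 : ℝ≥0∞) else 0) (ψ := fun n : ℕ∞ => (n : ℝ≥0∞))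
        Measurable.of_discrete Measurable.of_discrete)
  have i2 : ∫⁻ ω, (if (X ω ∩ (A ∩ B ∩ V)).encard = 1 then 1 else 0)
        * (if (X ω ∩ (V \ (A ∩ B ∩ V))).encard = 0 then 1 else 0) ∂P
      = ν (A ∩ B ∩ V) * P {ω | (X ω ∩ V).encard = 0} := by
    rw [hprod, ← mul_assoc, ← h.measure_count_eq_one hC hCA, ← hind 0 (hV.diff hC), ← hind 1 hC]
    exact lintegral_mul_eq_lintegral_mul_lintegral_of_indepFun
      (d (f := fun n => if n = 1 then 1 else 0) hC)
      (d (f := fun n => if n = 0 then 1 else 0) (hV.diff hC))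
      ((h.indepFun_count hC (hV.diff hC) disjoint_sdiff_right).comp
        (φ := fun n : ℕ∞ => if n = 1 then (1 : ℝ≥0∞) else 0)
        (ψ := fun n : ℕ∞ => if n = 0 then (1 : ℝ≥0∞) else 0)
        Measurable.of_discrete Measurable.of_discrete)
  have hae : ∀ᵐ ω ∂P, reducedMeasure A (X ω) (B ×ˢ voidEvent V) =
      (if (X ω ∩ V).encard = 0 then 1 else 0) * ((X ω ∩ ((A ∩ B) \ V)).encard : ℝ≥0∞)
      + (if (X ω ∩ (A ∩ B ∩ V)).encard = 1 then 1 else 0)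
        * (if (X ω ∩ (V \ (A ∩ B ∩ V))).encard = 0 then 1 else 0) := by
    filter_upwards [h.ae_finite hA hν] with ω hω
    exact reducedMeasure_prod_voidEvent hω hB hV
  rw [lintegral_congr_ae hae, lintegral_add_left, i1, i2, hvoid, inter_comm B A,
    ← measure_inter_add_sdiff (A ∩ B) hV]
  · ring
  · exact (d (f := fun n => if n = 0 then 1 else 0) hV).mul
      (d (f := fun n => (n : ℝ≥0∞)) ((hA.inter hB).diff hV))

/-- The **Mecke formula** for a Poisson process. -/
theorem lintegral_mecke [SigmaFinite ν] (h : IsPoissonProcess ν X P) {F : E × Config E → ℝ≥0∞}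
    (hF : Measurable F) :
    ∫⁻ ω, ∫⁻ x in X ω, F (x, Config.ofSet (X ω \ {x})) ∂Measure.count ∂P
      = ∫⁻ ω, ∫⁻ x, F (x, Config.ofSet (X ω)) ∂ν ∂P := by
  have hX := h.measurable_config
  have : IsProbabilityMeasure (P.map fun ω => Config.ofSet (X ω)) :=
    Measure.isProbabilityMeasure_map hX.aemeasurable
  -- The formula is known over sets of finite intensity, so the space is cut into countably many
  -- disjoint ones.
  set A : ℕ → Set E := disjointed (spanningSets ν) with hAdef
  have hAm : ∀ n, MeasurableSet (A n) := fun n =>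
    MeasurableSet.disjointed (measurableSet_spanningSets ν) n
  have hAν : ∀ n, ν (A n) ≠ ∞ := fun n =>
    measure_ne_top_of_subset (disjointed_subset _ _) (measure_spanningSets_lt_top ν n).ne
  have hAU : ⋃ n, A n = univ := by rw [hAdef, iUnion_disjointed, iUnion_spanningSets]
  have hAd : Pairwise (Function.onFun Disjoint A) := disjoint_disjointed _
  have hpiece : ∀ n, ∫⁻ ω, ∫⁻ z, F z ∂reducedMeasure (A n) (X ω) ∂P
      = ∫⁻ ω, ∫⁻ x in A n, F (x, Config.ofSet (X ω)) ∂ν ∂P := by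
    intro n
    have : IsFiniteMeasure (ν.restrict (A n)) := ⟨by simpa using (hAν n).lt_top⟩
    rw [← Measure.lintegral_bind (h.measurable_reducedMeasure (hAm n)).aemeasurable
      hF.aemeasurable, h.bind_reducedMeasure (hAm n) (hAν n), lintegral_prod_symm' _ hF,
      lintegral_map hF.lintegral_prod_left' hX]
  have hmeas : ∀ n, Measurable fun ω => ∫⁻ z, F z ∂reducedMeasure (A n) (X ω) := fun n =>
    (Measure.measurable_lintegral hF).comp (h.measurable_reducedMeasure (hAm n))
  have hmeas' : ∀ n, Measurable fun ω => ∫⁻ x in A n, F (x, Config.ofSet (X ω)) ∂ν := fun n =>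
    (hF.lintegral_prod_left' (μ := ν.restrict (A n))).comp hX
  have hfin : ∀ᵐ ω ∂P, ∀ n, (X ω ∩ A n).Finite :=
    ae_all_iff.2 fun n => h.ae_finite (hAm n) (hAν n)
  calc ∫⁻ ω, ∫⁻ x in X ω, F (x, Config.ofSet (X ω \ {x})) ∂Measure.count ∂P
      = ∫⁻ ω, ∑' n, ∫⁻ z, F z ∂reducedMeasure (A n) (X ω) ∂P := by
        refine lintegral_congr_ae ?_
        filter_upwards [hfin] with ω hω
        have hU : X ω = ⋃ n, X ω ∩ A n := by rw [← inter_iUnion, hAU, inter_univ]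
        conv_lhs => rw [hU]
        rw [lintegral_iUnion (fun n => (hω n).measurableSet)
          (fun i j hij => (hAd hij).mono inter_subset_right inter_subset_right)]
        refine tsum_congr fun n => ?_
        rw [reducedMeasure, if_pos (hω n), lintegral_map hF (measurable_pair_diff _), ← hU]
    _ = ∑' n, ∫⁻ ω, ∫⁻ z, F z ∂reducedMeasure (A n) (X ω) ∂P :=
        lintegral_tsum fun n => (hmeas n).aemeasurable
    _ = ∑' n, ∫⁻ ω, ∫⁻ x in A n, F (x, Config.ofSet (X ω)) ∂ν ∂P := tsum_congr hpiece
    _ = ∫⁻ ω, ∑' n, ∫⁻ x in A n, F (x, Config.ofSet (X ω)) ∂ν ∂P :=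
        (lintegral_tsum fun n => (hmeas' n).aemeasurable).symm
    _ = ∫⁻ ω, ∫⁻ x, F (x, Config.ofSet (X ω)) ∂ν ∂P := by
        refine lintegral_congr fun ω => ?_
        rw [← lintegral_iUnion hAm hAd, hAU, Measure.restrict_univ]

end IsPoissonProcess

/-! ### The walk along the lower left hull of a fixed point set -/

section Hull

/-- A locally finite set of points `(y, m)` of the open positive quadrant, with points
arbitrarily close to the axis `y = 0`. -/
structure IsNice (X : Set (ℝ × ℝ)) : Prop where
  pos : ∀ p ∈ X, 0 < p.1 ∧ 0 < p.2
  finite : ∀ c : ℝ, {p ∈ X | p.1 + p.2 ≤ c}.Finite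
  small : ∀ ε > 0, ∃ p ∈ X, p.1 < ε

/-- The state `z = (t, y, m)` is valid for `X` if `(y, m)` minimises `t * y + m` over `X`, and is
the minimiser with the smallest `y`. -/
structure IsValid (X : Set (ℝ × ℝ)) (z : ℝ × ℝ × ℝ) : Prop where
  mem : z.2 ∈ X
  le : ∀ p ∈ X, z.1 * z.2.1 + z.2.2 ≤ z.1 * p.1 + p.2
  lt : ∀ p ∈ X, p.1 < z.2.1 → z.1 * z.2.1 + z.2.2 < z.1 * p.1 + p.2

/-- The state `z'` is the state that follows `z`, along the lower left boundary of the convex hull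
of `X`. -/
structure IsStep (X : Set (ℝ × ℝ)) (z z' : ℝ × ℝ × ℝ) : Prop where
  time_lt : z.1 < z'.1
  lt : z'.2.1 < z.2.1
  line : z'.1 * z'.2.1 + z'.2.2 = z'.1 * z.2.1 + z.2.2
  valid : IsValid X z'

/-- The first time at which the minimiser `q` is superseded. -/
def hitTime (X : Config (ℝ × ℝ)) (q : ℝ × ℝ) : ℝ≥0∞ :=
  ⨅ p ∈ X.points, if p.1 < q.1 then ENNReal.ofReal ((p.2 - q.2) / (q.1 - p.1)) else ⊤

/-- The smallest value of `p.1 + p.2`. -/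
def minSum (X : Config (ℝ × ℝ)) : ℝ≥0∞ := ⨅ p ∈ X.points, ENNReal.ofReal (p.1 + p.2)

/-- The smallest first coordinate of a point at which `t * p.1 + p.2` is at most (hence equal to)
its minimum `h`. -/
def lowest (X : Config (ℝ × ℝ)) (t h : ℝ) : ℝ≥0∞ :=
  ⨆ k : ℕ, ⨅ p ∈ X.points, if t * p.1 + p.2 < h + 1 / (k + 1) then ENNReal.ofReal p.1 else ⊤

/-- The state at time `t`, if `h` is the minimum of `t * p.1 + p.2`. -/
def stateAt (X : Config (ℝ × ℝ)) (t h : ℝ) : ℝ × ℝ × ℝ :=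
  (t, (lowest X t h).toReal, h - t * (lowest X t h).toReal)

/-- The successive states `(Tₙ, Yₙ, Mₙ)` from time `1` on. -/
def hullState (X : Config (ℝ × ℝ)) : ℕ → ℝ × ℝ × ℝ
  | 0 => stateAt X 1 (minSum X).toReal
  | n + 1 => stateAt X (hitTime X (hullState X n).2).toReal
      ((hitTime X (hullState X n).2).toReal * (hullState X n).2.1 + (hullState X n).2.2)

variable {X : Set (ℝ × ℝ)} {z z' z'' : ℝ × ℝ × ℝ}

lemma IsNice.finite_le (hX : IsNice X) {t : ℝ} (ht : 0 < t) (c : ℝ) :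
    {p ∈ X | t * p.1 + p.2 ≤ c}.Finite := by
  refine (hX.finite (c / t + c)).subset fun p hp => ⟨hp.1, ?_⟩
  have h := hX.pos p hp.1
  have h2 : t * p.1 + p.2 ≤ c := hp.2
  have h3 : p.1 ≤ c / t := by
    rw [le_div_iff₀ ht]; nlinarith [h.2]
  have := mul_pos ht h.1
  linarith

lemma IsNice.diff_singleton (hX : IsNice X) (x : ℝ × ℝ) : IsNice (X \ {x}) where
  pos p hp := hX.pos p hp.1
  finite c := (hX.finite c).subset fun _ hp => ⟨hp.1.1, hp.2⟩
  small ε hε := by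
    by_cases hx : x ∈ X
    · obtain ⟨p, hp, h⟩ := hX.small (min ε x.1) (lt_min hε (hX.pos x hx).1)
      refine ⟨p, ⟨hp, ?_⟩, h.trans_le (min_le_left _ _)⟩
      rintro rfl
      exact absurd (h.trans_le (min_le_right _ _)) (lt_irrefl _)
    · obtain ⟨p, hp, h⟩ := hX.small ε hε
      exact ⟨p, ⟨hp, fun h' => hx (h' ▸ hp)⟩, h⟩

/-- As `t` grows, points with smaller `y` gain on the current one. If two steps had different times,
the point of the earlier would lie strictly below the current point at the later time, against
validity there. At equal times the smallest-`y` rule decides. -/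
lemma IsStep.unique (h : IsStep X z z') (h' : IsStep X z z'') : z' = z'' := by
  have key : ∀ {a b : ℝ × ℝ × ℝ}, IsStep X z a → IsStep X z b → b.1 ≤ a.1 := by
    intro a b ha hb
    by_contra! hlt
    have h1 := hb.valid.le _ ha.valid.mem
    rw [hb.line] at h1
    have h2 := ha.line
    nlinarith [mul_pos (sub_pos.2 hlt) (sub_pos.2 ha.lt)]
  have ht : z'.1 = z''.1 := le_antisymm (key h' h) (key h h')
  have key2 : ∀ {a b : ℝ × ℝ × ℝ}, IsStep X z a → IsStep X z b → a.1 = b.1 →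
      b.2.1 ≤ a.2.1 := by
    intro a b ha hb hab
    by_contra! hlt
    have h1 := hb.valid.lt _ ha.valid.mem hlt
    have h2 := ha.line
    rw [hb.line, ← hab] at h1
    linarith
  have hy : z'.2.1 = z''.2.1 := le_antisymm (key2 h' h ht.symm) (key2 h h' ht)
  have hm : z'.2.2 = z''.2.2 := by
    have h1 := h.line
    have h2 := h'.line
    rw [ht, hy] at h1
    linarith
  exact Prod.ext ht (Prod.ext hy hm)

lemma IsValid.unique (h : IsValid X z) (h' : IsValid X z') (ht : z.1 = z'.1) : z = z' := by
  have key : ∀ {a b : ℝ × ℝ × ℝ}, IsValid X a → IsValid X b → a.1 = b.1 → b.2.1 ≤ a.2.1 := by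
    intro a b ha hb hab
    by_contra! hlt
    have h1 := hb.lt _ ha.mem hlt
    have h2 := ha.le _ hb.mem
    rw [hab] at h2
    linarith
  have hy : z.2.1 = z'.2.1 := le_antisymm (key h' h ht.symm) (key h h' ht)
  have h1 := h.le _ h'.mem
  have h2 := h'.le _ h.mem
  rw [ht, hy] at h1
  rw [hy] at h2
  exact Prod.ext ht (Prod.ext hy (by linarith))

/-- Only finitely many points have value at most `h + 1`, so for large `k` the tolerance `1 / (k +
1)` selects exactly the minimisers. The tolerance makes the selecting condition open, as
measurability requires. -/
lemma lowest_eq (hX : IsNice X) {t h : ℝ} (ht : 0 < t) {p₀ : ℝ × ℝ} (hp₀ : p₀ ∈ X)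
    (heq : t * p₀.1 + p₀.2 = h) (hle : ∀ p ∈ X, h ≤ t * p.1 + p.2)
    (hmin : ∀ p ∈ X, t * p.1 + p.2 = h → p₀.1 ≤ p.1) :
    lowest X t h = ENNReal.ofReal p₀.1 := by
  refine le_antisymm (iSup_le fun k => ?_) ?_
  · refine (iInf₂_le p₀ hp₀).trans ?_
    rw [if_pos]
    rw [heq]
    have : (0 : ℝ) < 1 / ((k : ℝ) + 1) := by positivity
    linarith
  · have hfin : {p ∈ X | t * p.1 + p.2 ≤ h + 1}.Finite := hX.finite_le ht _
    have hev : ∀ᶠ k : ℕ in Filter.atTop, ∀ p ∈ {p ∈ X | t * p.1 + p.2 ≤ h + 1},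
        t * p.1 + p.2 < h + 1 / ((k : ℝ) + 1) → t * p.1 + p.2 = h := by
      rw [Filter.eventually_all_finite hfin]
      intro p hp
      by_cases hph : t * p.1 + p.2 = h
      · exact Filter.Eventually.of_forall fun _ _ => hph
      · have hlt : h < t * p.1 + p.2 := lt_of_le_of_ne (hle p hp.1) (Ne.symm hph)
        have := (tendsto_one_div_add_atTop_nhds_zero_nat (𝕜 := ℝ)).eventually_lt_const
          (sub_pos.2 hlt)
        filter_upwards [this] with k hk h2
        linarith
    obtain ⟨k, hk⟩ := hev.exists
    refine le_iSup_of_le k (le_iInf₂ fun p hp => ?_)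
    split_ifs with hlt
    · have h1 : (1 : ℝ) / ((k : ℝ) + 1) ≤ 1 := by
        rw [div_le_one (by positivity)]
        linarith [(Nat.cast_nonneg k : (0 : ℝ) ≤ k)]
      exact ENNReal.ofReal_le_ofReal (hmin p hp (hk p ⟨hp, by linarith⟩ hlt))
    · exact le_top

lemma isValid_stateAt (hX : IsNice X) {t h : ℝ} (ht : 0 < t)
    (hex : ∃ p ∈ X, t * p.1 + p.2 = h) (hle : ∀ p ∈ X, h ≤ t * p.1 + p.2) :
    IsValid X (stateAt X t h) := by
  have hfin : {p ∈ X | t * p.1 + p.2 ≤ h}.Finite := hX.finite_le ht _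
  obtain ⟨p₁, hp₁, hp₁'⟩ := hex
  obtain ⟨p₀, hp₀, hmin⟩ := exists_min_image _ (fun p : ℝ × ℝ => p.1) hfin ⟨p₁, hp₁, hp₁'.le⟩
  have heq : t * p₀.1 + p₀.2 = h := le_antisymm hp₀.2 (hle _ hp₀.1)
  have hlow := lowest_eq hX ht hp₀.1 heq hle fun p hp hph => hmin p ⟨hp, hph.le⟩
  have hst : stateAt X t h = (t, p₀) := by
    unfold stateAt
    rw [hlow, ENNReal.toReal_ofReal (hX.pos _ hp₀.1).1.le]
    refine Prod.ext rfl (Prod.ext rfl ?_)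
    change h - t * p₀.1 = p₀.2
    linarith
  rw [hst]
  refine ⟨hp₀.1, fun p hp => heq.le.trans (hle p hp), fun p hp hlt => ?_⟩
  refine lt_of_le_of_ne (heq.le.trans (hle p hp)) fun heq' => ?_
  have := hmin p ⟨hp, (heq'.symm.trans heq).le⟩
  exact absurd hlt (not_lt.2 this)

lemma isValid_hullState_zero (hX : IsNice X) : IsValid X (hullState X 0) := by
  obtain ⟨p₁, hp₁, -⟩ := hX.small 1 one_pos
  obtain ⟨p₀, hp₀, hmin⟩ := exists_min_image _ (fun p : ℝ × ℝ => p.1 + p.2)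
    (hX.finite (p₁.1 + p₁.2)) ⟨p₁, hp₁, le_rfl⟩
  have hle : ∀ p ∈ X, p₀.1 + p₀.2 ≤ p.1 + p.2 := by
    intro p hp
    by_cases h : p.1 + p.2 ≤ p₁.1 + p₁.2
    · exact hmin p ⟨hp, h⟩
    · have h2 : p₀.1 + p₀.2 ≤ p₁.1 + p₁.2 := hp₀.2
      linarith
  have hs : minSum X = ENNReal.ofReal (p₀.1 + p₀.2) :=
    le_antisymm (iInf₂_le p₀ hp₀.1)
      (le_iInf₂ fun p hp => ENNReal.ofReal_le_ofReal (hle p hp))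
  have hpos := hX.pos _ hp₀.1
  change IsValid X (stateAt X 1 (minSum X).toReal)
  rw [hs, ENNReal.toReal_ofReal (by linarith)]
  refine isValid_stateAt hX one_pos ⟨p₀, hp₀.1, by ring⟩ fun p hp => ?_
  linarith [hle p hp]

/-- Points with smaller `y` catch up at their level time; those with larger or equal `y` never do.
The infimum is attained because a bound on the level time bounds both coordinates. -/
lemma exists_hitTime (hX : IsNice X) (h : IsValid X z) (ht : 0 ≤ z.1) :
    ∃ t : ℝ, hitTime X z.2 = ENNReal.ofReal t ∧ z.1 < t ∧
      (∃ p ∈ X, p.1 < z.2.1 ∧ t * p.1 + p.2 = t * z.2.1 + z.2.2) ∧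
      ∀ p ∈ X, t * z.2.1 + z.2.2 ≤ t * p.1 + p.2 := by
  obtain ⟨p₁, hp₁, hp₁y⟩ := hX.small z.2.1 (hX.pos _ h.mem).1
  set τ : ℝ × ℝ → ℝ := fun p => (p.2 - z.2.2) / (z.2.1 - p.1) with hτ
  have hτt : ∀ p ∈ X, p.1 < z.2.1 → z.1 < τ p := by
    intro p hp hlt
    rw [hτ, lt_div_iff₀ (sub_pos.2 hlt)]
    linarith [h.lt p hp hlt]
  have hfin : {p ∈ X | p.1 < z.2.1 ∧ τ p ≤ τ p₁}.Finite := by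
    refine (hX.finite (z.2.1 + (z.2.2 + τ p₁ * z.2.1))).subset fun p hp => ⟨hp.1, ?_⟩
    obtain ⟨hpX, hlt, hle⟩ := hp
    rw [hτ, div_le_iff₀ (sub_pos.2 hlt)] at hle
    have h1 := hτt p₁ hp₁ hp₁y
    have h2 := hX.pos p hpX
    have h3 := mul_pos (ht.trans_lt h1) h2.1
    change p.2 - z.2.2 ≤ τ p₁ * (z.2.1 - p.1) at hle
    linarith
  obtain ⟨p₀, ⟨hp₀, hp₀y, hp₀τ⟩, hmin⟩ := exists_min_image _ τ hfin ⟨p₁, hp₁, hp₁y, le_rfl⟩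
  have hle : ∀ p ∈ X, p.1 < z.2.1 → τ p₀ ≤ τ p := by
    intro p hp hlt
    by_cases hc : τ p ≤ τ p₁
    · exact hmin p ⟨hp, hlt, hc⟩
    · linarith
  have hline : τ p₀ * (z.2.1 - p₀.1) = p₀.2 - z.2.2 :=
    div_mul_cancel₀ _ (sub_pos.2 hp₀y).ne'
  refine ⟨τ p₀, le_antisymm ?_ ?_, hτt p₀ hp₀ hp₀y, ⟨p₀, hp₀, hp₀y, by linarith⟩, fun p hp => ?_⟩
  · refine (iInf₂_le p₀ hp₀).trans ?_
    rw [if_pos hp₀y]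
  · refine le_iInf₂ fun p hp => ?_
    split_ifs with hlt
    · exact ENNReal.ofReal_le_ofReal (hle p hp hlt)
    · exact le_top
  · rcases lt_or_ge p.1 z.2.1 with hlt | hge
    · have := hle p hp hlt
      rw [hτ, le_div_iff₀ (sub_pos.2 hlt)] at this
      change τ p₀ * (z.2.1 - p.1) ≤ p.2 - z.2.2 at this
      linarith
    · have h1 := h.le p hp
      nlinarith [mul_nonneg (sub_nonneg.2 (hτt p₀ hp₀ hp₀y).le) (sub_nonneg.2 hge)]

lemma isStep_stateAt (hX : IsNice X) (h : IsValid X z) (ht : 0 ≤ z.1) :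
    IsStep X z (stateAt X (hitTime X z.2).toReal
      ((hitTime X z.2).toReal * z.2.1 + z.2.2)) := by
  obtain ⟨t, hhit, hlt, ⟨p, hp, hpy, hpeq⟩, hle⟩ := exists_hitTime hX h ht
  rw [hhit, ENNReal.toReal_ofReal (ht.trans hlt.le)]
  have hv := isValid_stateAt hX (ht.trans_lt hlt) ⟨p, hp, hpeq⟩ hle
  have hline : t * (stateAt X t (t * z.2.1 + z.2.2)).2.1 +
      (stateAt X t (t * z.2.1 + z.2.2)).2.2 = t * z.2.1 + z.2.2 := by
    simp only [stateAt]; ring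
  refine ⟨hlt, ?_, hline, hv⟩
  by_contra! hge
  have h1 := hv.lt p hp (hpy.trans_le hge)
  change t * _ + _ < t * p.1 + p.2 at h1
  rw [hline, hpeq] at h1
  exact lt_irrefl _ h1

lemma isValid_hullState (hX : IsNice X) (n : ℕ) :
    IsValid X (hullState X n) ∧ 1 ≤ (hullState X n).1 := by
  induction n with
  | zero => exact ⟨isValid_hullState_zero hX, le_rfl⟩
  | succ n ih =>
    have h := isStep_stateAt hX ih.1 (zero_le_one.trans ih.2)
    exact ⟨h.valid, ih.2.trans h.time_lt.le⟩

lemma isStep_hullState (hX : IsNice X) (n : ℕ) :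
    IsStep X (hullState X n) (hullState X (n + 1)) :=
  isStep_stateAt hX (isValid_hullState hX n).1 (zero_le_one.trans (isValid_hullState hX n).2)

/-- Steps are unique, so a chain of valid steps starting at time `1` is the walk itself. This
compares the walks of `X` and `X \ {x}`. -/
lemma hullState_eq_of_isStep (hX : IsNice X) {u : ℕ → ℝ × ℝ × ℝ} (h0 : IsValid X (u 0))
    (h1 : (u 0).1 = 1) {n : ℕ} (hstep : ∀ i < n, IsStep X (u i) (u (i + 1))) :
    ∀ i ≤ n, hullState X i = u i := by
  intro i
  induction i with
  | zero => exact fun _ => (isValid_hullState_zero hX).unique h0 h1.symm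
  | succ i ih =>
    intro hi
    have := isStep_hullState hX i
    rw [ih (by omega)] at this
    exact this.unique (hstep i (by omega))

lemma hullState_strictMono (hX : IsNice X) : StrictMono fun n => (hullState X n).1 :=
  strictMono_nat_of_lt_succ fun n => (isStep_hullState hX n).time_lt

lemma hullState_strictAnti (hX : IsNice X) : StrictAnti fun n => (hullState X n).2.1 :=
  strictAnti_nat_of_succ_lt fun n => (isStep_hullState hX n).lt

/-! ### Deleting and inserting a point -/

/-- The vertices up to `n` have first coordinate at least `Yₙ`, so none of them is `x`, and deleting
a point cannot destroy minimality. -/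
lemma hullState_diff_singleton (hX : IsNice X) {x : ℝ × ℝ} {n : ℕ}
    (hx : x.1 < (hullState X n).2.1) {i : ℕ} (hi : i ≤ n) :
    hullState (X \ {x} : Set (ℝ × ℝ)) i = hullState X i := by
  have hval : ∀ i ≤ n, IsValid (X \ {x}) (hullState X i) := by
    intro i hi
    have h := (isValid_hullState hX i).1
    refine ⟨⟨h.mem, ?_⟩, fun p hp => h.le p hp.1, fun p hp => h.lt p hp.1⟩
    intro he
    have he : (hullState X i).2 = x := he
    have := (hullState_strictAnti hX).antitone hi
    simp only [he] at this
    linarith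
  refine hullState_eq_of_isStep (hX.diff_singleton x) (u := hullState X)
    (hval 0 (Nat.zero_le _)) rfl (n := n) (fun i hi => ?_) i hi
  have h := isStep_hullState hX i
  exact ⟨h.time_lt, h.lt, h.line, hval (i + 1) (by omega)⟩

/-- The time at which the points `q` and `x` are level. -/
def levelTime (q x : ℝ × ℝ) : ℝ := (x.2 - q.2) / (q.1 - x.1)

/-- The level-time condition puts `x` strictly above vertex `n` at time `Tₙ`. As `x` has the smaller
`y`, it is even further above at earlier times, so it does not disturb the first `n` steps. -/
lemma hullState_of_diff_singleton (hX : IsNice X) {x : ℝ × ℝ} {n : ℕ}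
    (hy : x.1 < (hullState (X \ {x} : Set (ℝ × ℝ)) n).2.1)
    (ht : (hullState (X \ {x} : Set (ℝ × ℝ)) n).1
      < levelTime (hullState (X \ {x} : Set (ℝ × ℝ)) n).2 x)
    {i : ℕ} (hi : i ≤ n) :
    hullState X i = hullState (X \ {x} : Set (ℝ × ℝ)) i := by
  have hX' := hX.diff_singleton x
  set u : ℕ → ℝ × ℝ × ℝ := fun i => hullState (X \ {x} : Set (ℝ × ℝ)) i with hu
  rw [levelTime, lt_div_iff₀ (sub_pos.2 hy)] at ht
  have hval : ∀ i ≤ n, IsValid X (u i) := by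
    intro i hi
    have h := (isValid_hullState hX' i).1
    have hlt : (u i).1 * (u i).2.1 + (u i).2.2 < (u i).1 * x.1 + x.2 := by
      have h1 := h.le _ (isValid_hullState hX' n).1.mem
      have h2 : (u i).1 ≤ (u n).1 := (hullState_strictMono hX').monotone hi
      change (u i).1 * (u i).2.1 + (u i).2.2 ≤ (u i).1 * (u n).2.1 + (u n).2.2 at h1
      change (u n).1 * ((u n).2.1 - x.1) < x.2 - (u n).2.2 at ht
      change x.1 < (u n).2.1 at hy
      nlinarith [mul_nonneg (sub_nonneg.2 h2) (sub_nonneg.2 hy.le)]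
    refine ⟨h.mem.1, fun p hp => ?_, fun p hp hpy => ?_⟩
    · by_cases hpx : p = x
      · rw [hpx]; exact hlt.le
      · exact h.le p ⟨hp, hpx⟩
    · by_cases hpx : p = x
      · rw [hpx]; exact hlt
      · exact h.lt p ⟨hp, hpx⟩ hpy
  refine hullState_eq_of_isStep hX (u := u) (hval 0 (Nat.zero_le _)) rfl
    (n := n) (fun i hi => ?_) i hi
  have h := isStep_hullState hX' i
  exact ⟨h.time_lt, h.lt, h.line, hval (i + 1) (by omega)⟩

lemma hullState_succ_of_diff_singleton (hX : IsNice X) {x : ℝ × ℝ} (hx : x ∈ X) {n : ℕ}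
    (hy : x.1 < (hullState (X \ {x} : Set (ℝ × ℝ)) n).2.1)
    (ht : (hullState (X \ {x} : Set (ℝ × ℝ)) n).1
      < levelTime (hullState (X \ {x} : Set (ℝ × ℝ)) n).2 x)
    (ht' : levelTime (hullState (X \ {x} : Set (ℝ × ℝ)) n).2 x
      < (hullState (X \ {x} : Set (ℝ × ℝ)) (n + 1)).1) :
    hullState X (n + 1) = (levelTime (hullState (X \ {x} : Set (ℝ × ℝ)) n).2 x, x) := by
  have hX' := hX.diff_singleton x
  have hz := hullState_of_diff_singleton hX hy ht le_rfl
  set z := hullState (X \ {x} : Set (ℝ × ℝ)) n with hzdef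
  set τ := levelTime z.2 x with hτ
  have hs := isStep_hullState hX n
  rw [hz] at hs
  have hv := (isValid_hullState hX' n).1
  rw [← hzdef] at hv
  obtain ⟨t, hhit, hlt, -, hle⟩ := exists_hitTime hX' hv
    (zero_le_one.trans (isValid_hullState hX' n).2)
  have hT : (hullState (X \ {x} : Set (ℝ × ℝ)) (n + 1)).1 = t := by
    change (hitTime (X \ {x} : Set (ℝ × ℝ)) z.2).toReal = t
    rw [hhit, ENNReal.toReal_ofReal]
    exact ((zero_le_one.trans (isValid_hullState hX' n).2).trans hlt.le)
  rw [hT] at ht'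
  have hline : τ * (z.2.1 - x.1) = x.2 - z.2.2 := div_mul_cancel₀ _ (sub_pos.2 hy).ne'
  -- No point undercuts `z` at the later time `t`; at `τ < t`, points with smaller `y` are therefore
  -- strictly above `z`, which is level with `x`.
  have hstrict : ∀ p ∈ X, p ≠ x → p.1 < z.2.1 → τ * x.1 + x.2 < τ * p.1 + p.2 := by
    intro p hp hpx hpy
    have h1 := hle p ⟨hp, hpx⟩
    nlinarith [mul_pos (sub_pos.2 ht') (sub_pos.2 hpy)]
  refine hs.unique ⟨ht, hy, by change τ * x.1 + x.2 = τ * z.2.1 + z.2.2; linarith, hx,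
    fun p hp => ?_, fun p hp hpy => ?_⟩
  · change τ * x.1 + x.2 ≤ τ * p.1 + p.2
    by_cases hpx : p = x
    · rw [hpx]
    · rcases lt_or_ge p.1 z.2.1 with hpy | hpy
      · exact (hstrict p hp hpx hpy).le
      · have h1 := hv.le p ⟨hp, hpx⟩
        nlinarith [mul_nonneg (sub_nonneg.2 ht.le) (sub_nonneg.2 hpy)]
  · change p.1 < x.1 at hpy
    refine hstrict p hp ?_ (hpy.trans hy)
    rintro rfl
    exact lt_irrefl _ hpy

lemma hullState_time_le_diff_singleton (hX : IsNice X) {x : ℝ × ℝ} {n : ℕ}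
    (hx : x.1 < (hullState X n).2.1) :
    (hullState X (n + 1)).1 ≤ (hullState (X \ {x} : Set (ℝ × ℝ)) (n + 1)).1 := by
  have hX' := hX.diff_singleton x
  have hz := hullState_diff_singleton hX hx le_rfl
  obtain ⟨t, hhit, -⟩ := exists_hitTime hX' (isValid_hullState hX' n).1
    (zero_le_one.trans (isValid_hullState hX' n).2)
  change (hitTime X (hullState X n).2).toReal ≤
    (hitTime (X \ {x} : Set (ℝ × ℝ)) (hullState (X \ {x} : Set (ℝ × ℝ)) n).2).toReal
  refine ENNReal.toReal_mono (by rw [hhit]; exact ENNReal.ofReal_ne_top) ?_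
  rw [hz]
  exact le_iInf₂ fun p hp => iInf₂_le p hp.1

lemma levelTime_hullState (hX : IsNice X) (n : ℕ) :
    levelTime (hullState X n).2 (hullState X (n + 1)).2 = (hullState X (n + 1)).1 := by
  have h := isStep_hullState hX n
  rw [levelTime, div_eq_iff (sub_pos.2 h.lt).ne']
  linarith [h.line]

end Hull

/-! ### Measurability of the walk in the configuration -/

section Measurability

/-- The infimum is below `c` when some point meets the open set `g < c`. Countably many basic boxes
cover this set, and meeting a box is the complement of a void event. -/
lemma measurable_iInf_points {Z E : Type*} [TopologicalSpace Z] [SecondCountableTopology Z]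
    [MeasurableSpace Z] [OpensMeasurableSpace Z] [TopologicalSpace E] [SecondCountableTopology E]
    [MeasurableSpace E] [OpensMeasurableSpace E] {g : Z × E → ℝ≥0∞}
    (hg : ∀ c, IsOpen {w | g w < c}) :
    Measurable fun w : Z × Config E => ⨅ p ∈ w.2.points, g (w.1, p) := by
  refine measurable_of_Iio fun c => ?_
  have hbZ := TopologicalSpace.isBasis_countableBasis Z
  have hbE := TopologicalSpace.isBasis_countableBasis E
  have hb := hbZ.prod hbE
  have hset : (fun w : Z × Config E => ⨅ p ∈ w.2.points, g (w.1, p)) ⁻¹' Iio c =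
      ⋃ U ∈ TopologicalSpace.countableBasis Z, ⋃ V ∈ TopologicalSpace.countableBasis E,
        ⋃ _ : U ×ˢ V ⊆ {w | g w < c}, U ×ˢ (voidEvent V)ᶜ := by
    ext ⟨z, X⟩
    simp only [mem_preimage, mem_Iio, iInf_lt_iff, mem_iUnion, mem_prod, mem_compl_iff,
      exists_prop]
    constructor
    · rintro ⟨p, hp, hlt⟩
      obtain ⟨_, ⟨U, hU, V, hV, rfl⟩, hmem, hsub⟩ := hb.exists_subset_of_mem_open
        (show (z, p) ∈ {w | g w < c} from hlt) (hg c)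
      refine ⟨U, hU, V, hV, hsub, hmem.1, fun h => ?_⟩
      have h : X.points ∩ V = ∅ := h
      exact (h ▸ (⟨hp, hmem.2⟩ : p ∈ X.points ∩ V) : p ∈ (∅ : Set E))
    · rintro ⟨U, hU, V, hV, hsub, hz, hne⟩
      have hne : X.points ∩ V ≠ ∅ := hne
      obtain ⟨p, hp, hpV⟩ := nonempty_iff_ne_empty.2 hne
      exact ⟨p, hp, hsub (show (z, p) ∈ U ×ˢ V from ⟨hz, hpV⟩)⟩
  rw [hset]
  refine MeasurableSet.biUnion (TopologicalSpace.countable_countableBasis Z) fun U hU =>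
    MeasurableSet.biUnion (TopologicalSpace.countable_countableBasis E) fun V hV =>
      MeasurableSet.iUnion fun _ => ?_
  exact (hbZ.isOpen hU).measurableSet.prod
    (measurableSet_voidEvent (hbE.isOpen hV).measurableSet).compl

lemma isOpen_lt_ite_top {W : Type*} [TopologicalSpace W] {p : W → Prop} [DecidablePred p]
    (hp : IsOpen {w | p w}) {f : W → ℝ≥0∞} (hf : ContinuousOn f {w | p w}) (c : ℝ≥0∞) :
    IsOpen {w | (if p w then f w else ⊤) < c} := by
  have : {w | (if p w then f w else ⊤) < c} = {w | p w} ∩ f ⁻¹' Iio c := by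
    ext w
    by_cases h : p w <;> simp [h]
  rw [this]
  exact hf.isOpen_inter_preimage hp isOpen_Iio

lemma measurable_hitTime :
    Measurable fun w : (ℝ × ℝ) × Config (ℝ × ℝ) => hitTime w.2 w.1 := by
  refine measurable_iInf_points (g := fun w : (ℝ × ℝ) × (ℝ × ℝ) =>
    if w.2.1 < w.1.1 then ENNReal.ofReal ((w.2.2 - w.1.2) / (w.1.1 - w.2.1)) else ⊤)
    fun c => isOpen_lt_ite_top (isOpen_lt (by fun_prop) (by fun_prop)) ?_ c
  refine ENNReal.continuous_ofReal.comp_continuousOn ?_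
  refine ContinuousOn.div (by fun_prop) (by fun_prop) fun w hw => ?_
  exact (sub_pos.2 hw).ne'

lemma measurable_lowest :
    Measurable fun w : (ℝ × ℝ) × Config (ℝ × ℝ) => lowest w.2 w.1.1 w.1.2 := by
  refine Measurable.iSup fun k => ?_
  refine measurable_iInf_points (g := fun w : (ℝ × ℝ) × (ℝ × ℝ) =>
    if w.1.1 * w.2.1 + w.2.2 < w.1.2 + 1 / (k + 1) then ENNReal.ofReal w.2.1 else ⊤)
    fun c => isOpen_lt_ite_top (isOpen_lt (by fun_prop) (by fun_prop)) ?_ c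
  exact (ENNReal.continuous_ofReal.comp (by fun_prop)).continuousOn

lemma measurable_minSum : Measurable minSum := by
  have := measurable_iInf_points (g := fun w : ℝ × (ℝ × ℝ) => ENNReal.ofReal (w.2.1 + w.2.2))
    fun c => isOpen_lt (ENNReal.continuous_ofReal.comp (by fun_prop)) continuous_const
  exact this.comp (measurable_const (a := (0 : ℝ)) |>.prodMk measurable_id)

lemma measurable_stateAt :
    Measurable fun w : (ℝ × ℝ) × Config (ℝ × ℝ) => stateAt w.2 w.1.1 w.1.2 := by
  have h := measurable_lowest.ennreal_toReal
  unfold stateAt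
  fun_prop

lemma measurable_hullState (n : ℕ) : Measurable fun X => hullState X n := by
  induction n with
  | zero =>
    exact measurable_stateAt.comp
      ((measurable_const.prodMk measurable_minSum.ennreal_toReal).prodMk measurable_id)
  | succ n ih =>
    have h := (measurable_hitTime.comp (ih.snd.prodMk measurable_id)).ennreal_toReal
    exact measurable_stateAt.comp
      ((h.prodMk ((h.mul ih.snd.fst).add ih.snd.snd)).prodMk measurable_id)

end Measurability

/-! ### The one-step identity -/

/-- The image of the intensity of the line process, in the coordinates (intercept on the `y`-axis,
slope), restricted to the positive quadrant. -/
def quadrantIntensity : Measure (ℝ × ℝ) :=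
  ((2 : ℝ≥0∞)⁻¹ • (volume : Measure (ℝ × ℝ))).restrict (Ioi 0 ×ˢ Ioi 0)

instance : SigmaFinite quadrantIntensity := by
  unfold quadrantIntensity
  have : SigmaFinite ((2 : ℝ≥0∞)⁻¹ • (volume : Measure (ℝ × ℝ))) := by
    have h : SigmaFinite ((2 : NNReal)⁻¹ • (volume : Measure (ℝ × ℝ))) := inferInstance
    convert! h using 1
    rw [ENNReal.smul_def]
    simp
  infer_instance

lemma lintegral_comp_sub_div {g : ℝ → ℝ≥0∞} (hg : Measurable g) (m : ℝ) {a : ℝ} (ha : 0 < a) :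
    ∫⁻ x, g ((x - m) / a) = ENNReal.ofReal a * ∫⁻ t, g t := by
  rw [lintegral_sub_right_eq_self (fun x => g (x / a)) m]
  simp_rw [div_eq_inv_mul]
  rw [← lintegral_map hg (measurable_const_mul a⁻¹), Real.map_volume_mul_left (inv_pos.2 ha).ne',
    lintegral_smul_measure, inv_inv, abs_of_pos ha, smul_eq_mul]

/-- The mean of `d` at the next intercept, up to normalisation. -/
def jumpIntegral (d : ℝ → ℝ≥0∞) (Y : ℝ) : ℝ≥0∞ :=
  2⁻¹ * ∫⁻ y in Ioo 0 Y, ENNReal.ofReal (Y - y) * d y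

/-- For fixed `y`, substitute `m = q.2 + t (q.1 - y)`. The Jacobian `q.1 - y` is the weight in
`jumpIntegral`. -/
lemma lintegral_quadrant {b d c : ℝ → ℝ≥0∞} (hd : Measurable d) (hc : Measurable c)
    {I : Set ℝ} (hI : MeasurableSet I) (hI0 : I ⊆ Ioi 0) (q : ℝ × ℝ) (hq : 0 ≤ q.2) :
    ∫⁻ x, {x : ℝ × ℝ | x.1 < q.1 ∧ levelTime q x ∈ I}.indicator
        (fun x => b q.1 * d x.1 * c (levelTime q x)) x ∂quadrantIntensity
      = b q.1 * jumpIntegral d q.1 * ∫⁻ t in I, c t := by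
  have hlev : Measurable (levelTime q) := by unfold levelTime; fun_prop
  have hS : MeasurableSet {x : ℝ × ℝ | x.1 < q.1 ∧ levelTime q x ∈ I} :=
    (measurableSet_lt measurable_fst measurable_const).inter (hlev hI)
  have hF : Measurable ({x : ℝ × ℝ | x.1 < q.1 ∧ levelTime q x ∈ I}.indicator
        (fun x => b q.1 * d x.1 * c (levelTime q x))) :=
    Measurable.indicator (by fun_prop) hS
  rw [quadrantIntensity, Measure.restrict_smul, lintegral_smul_measure, Measure.volume_eq_prod,
    ← Measure.prod_restrict, lintegral_prod _ hF.aemeasurable]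
  have hinner : ∀ y : ℝ, ∫⁻ m in Ioi 0, {x : ℝ × ℝ | x.1 < q.1 ∧ levelTime q x ∈ I}.indicator
        (fun x => b q.1 * d x.1 * c (levelTime q x)) (y, m)
      = (Iio q.1).indicator (fun y => (b q.1 * ∫⁻ t in I, c t) *
          (ENNReal.ofReal (q.1 - y) * d y)) y := by
    intro y
    by_cases hy : y < q.1
    · have hpos := sub_pos.2 hy
      rw [indicator_of_mem (by exact hy), ← lintegral_indicator measurableSet_Ioi]
      have : ∀ m, (Ioi (0 : ℝ)).indicator (fun m =>
          {x : ℝ × ℝ | x.1 < q.1 ∧ levelTime q x ∈ I}.indicator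
          (fun x => b q.1 * d x.1 * c (levelTime q x)) (y, m)) m
          = b q.1 * d y * I.indicator c ((m - q.2) / (q.1 - y)) := by
        intro m
        by_cases hm : (m - q.2) / (q.1 - y) ∈ I
        -- The restriction to `m > 0` costs nothing: `t > 0` and `q.2 ≥ 0` force it.
        · have hm0 : 0 < m := by
            have : 0 < (m - q.2) / (q.1 - y) := hI0 hm
            have := (div_pos_iff_of_pos_right hpos).1 this
            linarith
          rw [indicator_of_mem (by exact hm0), indicator_of_mem (by exact ⟨hy, hm⟩),
            indicator_of_mem hm]
          rfl
        · rw [indicator_of_notMem hm, mul_zero]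
          refine indicator_apply_eq_zero.2 fun _ => indicator_of_notMem (fun h => hm h.2) _
      simp_rw [this]
      have hcm : Measurable fun m : ℝ => I.indicator c ((m - q.2) / (q.1 - y)) :=
        (hc.indicator hI).comp (by fun_prop)
      rw [lintegral_const_mul _ hcm,
        lintegral_comp_sub_div (hc.indicator hI) _ hpos, lintegral_indicator hI]
      ring
    · rw [indicator_of_notMem (by exact hy)]
      refine (lintegral_congr fun m => ?_).trans lintegral_zero
      exact indicator_of_notMem (fun h => hy h.1) _
  simp_rw [hinner]
  rw [lintegral_indicator measurableSet_Iio, Measure.restrict_restrict measurableSet_Iio,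
    lintegral_const_mul _ (by fun_prop), inter_comm, Ioi_inter_Iio, jumpIntegral, smul_eq_mul]
  ring

lemma jumpIntegral_pow (k : ℕ) {Y : ℝ} (hY : 0 ≤ Y) :
    jumpIntegral (fun y => ENNReal.ofReal (y ^ k)) Y
      = ENNReal.ofReal (1 / (2 * (k + 1) * (k + 2)) * Y ^ (k + 2)) := by
  have h1 : ∫⁻ y in Ioo 0 Y, ENNReal.ofReal (Y - y) * ENNReal.ofReal (y ^ k)
      = ENNReal.ofReal (∫ y in (0 : ℝ)..Y, (Y * y ^ k - y ^ (k + 1))) := by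
    rw [intervalIntegral.integral_of_le hY, setLIntegral_congr Ioo_ae_eq_Ioc,
      ofReal_integral_eq_lintegral_ofReal]
    · refine setLIntegral_congr_fun measurableSet_Ioc fun y hy => ?_
      rw [← ENNReal.ofReal_mul (sub_nonneg.2 hy.2)]
      congr 1
      ring
    · exact (Continuous.integrableOn_Icc (by fun_prop)).mono_set Ioc_subset_Icc_self
    · filter_upwards [ae_restrict_mem measurableSet_Ioc] with y hy
      have : Y * y ^ k - y ^ (k + 1) = (Y - y) * y ^ k := by ring
      rw [this]
      exact mul_nonneg (sub_nonneg.2 hy.2) (pow_nonneg hy.1.le k)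
  have h2 : ∫ y in (0 : ℝ)..Y, (Y * y ^ k - y ^ (k + 1))
      = 1 / ((k + 1) * (k + 2)) * Y ^ (k + 2) := by
    rw [intervalIntegral.integral_sub, intervalIntegral.integral_const_mul, integral_pow,
      integral_pow]
    · have h3 : (k : ℝ) + 1 ≠ 0 := by positivity
      have h4 : (k : ℝ) + 2 ≠ 0 := by positivity
      have h5 : ((k + 1 : ℕ) : ℝ) + 1 = k + 2 := by push_cast; ring
      rw [h5]
      field_simp
      simp
      ring
    · exact Continuous.intervalIntegrable (by fun_prop) _ _
    · exact Continuous.intervalIntegrable (by fun_prop) _ _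
  have h6 : (2 : ℝ≥0∞)⁻¹ = ENNReal.ofReal (1 / 2) := by
    rw [one_div, ENNReal.ofReal_inv_of_pos two_pos]; simp
  rw [jumpIntegral, h1, h2, h6, ← ENNReal.ofReal_mul (by positivity)]
  congr 1
  field_simp

lemma IsNice.countable {X : Set (ℝ × ℝ)} (hX : IsNice X) : X.Countable := by
  have : X = ⋃ k : ℕ, {p ∈ X | p.1 + p.2 ≤ k} := by
    ext p
    simp only [mem_iUnion, mem_ofPred_eq, exists_and_left]
    exact ⟨fun h => ⟨h, exists_nat_ge _⟩, fun h => h.1⟩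
  rw [this]
  exact countable_iUnion fun k => (hX.finite k).countable

/-- The contribution of the point `x` as a possible `(n + 1)`-st vertex, inserted into `X`, when its
level time lies between the `n`-th and the `(n + 1)`-st time of `X`; that interval is
`I Tₙ Tₙ₊₁`. -/
def vertexWeight (b d c : ℝ → ℝ≥0∞) (I : ℝ → ℝ → Set ℝ) (n : ℕ)
    (w : (ℝ × ℝ) × Config (ℝ × ℝ)) : ℝ≥0∞ :=
  {x : ℝ × ℝ | x.1 < (hullState w.2 n).2.1 ∧ levelTime (hullState w.2 n).2 x ∈
      I (hullState w.2 n).1 (hullState w.2 (n + 1)).1}.indicator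
    (fun x => b (hullState w.2 n).2.1 * d x.1 * c (levelTime (hullState w.2 n).2 x)) w.1

lemma measurable_vertexWeight {b d c : ℝ → ℝ≥0∞} (hb : Measurable b) (hd : Measurable d)
    (hc : Measurable c) {I : ℝ → ℝ → Set ℝ}
    (hI : MeasurableSet {w : ℝ × ℝ × ℝ | w.1 ∈ I w.2.1 w.2.2}) (n : ℕ) :
    Measurable (vertexWeight b d c I n) := by
  have h0 : Measurable fun w : (ℝ × ℝ) × Config (ℝ × ℝ) => hullState w.2 n :=
    (measurable_hullState n).comp measurable_snd
  have h1 : Measurable fun w : (ℝ × ℝ) × Config (ℝ × ℝ) => hullState w.2 (n + 1) :=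
    (measurable_hullState (n + 1)).comp measurable_snd
  have hlev : Measurable fun w : (ℝ × ℝ) × Config (ℝ × ℝ) =>
      levelTime (hullState w.2 n).2 w.1 := by
    unfold levelTime
    fun_prop
  have hS : MeasurableSet {w : (ℝ × ℝ) × Config (ℝ × ℝ) | w.1.1 < (hullState w.2 n).2.1 ∧
      levelTime (hullState w.2 n).2 w.1 ∈ I (hullState w.2 n).1 (hullState w.2 (n + 1)).1} :=
    (measurableSet_lt measurable_fst.fst h0.snd.fst).inter
      ((hlev.prodMk (h0.fst.prodMk h1.fst)) hI)
  have hf : Measurable fun w : (ℝ × ℝ) × Config (ℝ × ℝ) =>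
      b (hullState w.2 n).2.1 * d w.1.1 * c (levelTime (hullState w.2 n).2 w.1) := by
    fun_prop
  exact hf.indicator hS

/-- Vertex `n + 1` is itself one term of the sum. Deleting it can only delay the next time, possibly
not strictly when points tie, whence the closed right end. -/
lemma le_lintegral_vertexWeight {X : Set (ℝ × ℝ)} (hX : IsNice X) (b d c : ℝ → ℝ≥0∞) (n : ℕ) :
    b (hullState X n).2.1 * d (hullState X (n + 1)).2.1 * c (hullState X (n + 1)).1
      ≤ ∫⁻ x in X, vertexWeight b d c Ioc n (x, Config.ofSet (X \ {x})) ∂Measure.count := by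
  set x := (hullState X (n + 1)).2 with hx
  have hmem : x ∈ X := (isValid_hullState hX (n + 1)).1.mem
  have hstep := isStep_hullState hX n
  have hlt : x.1 < (hullState X n).2.1 := hstep.lt
  have hz : hullState (Config.ofSet (X \ {x})) n = hullState X n :=
    hullState_diff_singleton hX hlt le_rfl
  have hval : vertexWeight b d c Ioc n (x, Config.ofSet (X \ {x}))
      = b (hullState X n).2.1 * d x.1 * c (hullState X (n + 1)).1 := by
    rw [vertexWeight]
    simp only [hz]
    rw [indicator_of_mem]
    · rw [hx, levelTime_hullState hX n]
    · refine ⟨hlt, ?_⟩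
      have hl : levelTime (hullState X n).2 x = (hullState X (n + 1)).1 :=
        levelTime_hullState hX n
      rw [hl]
      exact ⟨hstep.time_lt, hullState_time_le_diff_singleton hX hlt⟩
  calc b (hullState X n).2.1 * d x.1 * c (hullState X (n + 1)).1
      = ∫⁻ x in {x}, vertexWeight b d c Ioc n (x, Config.ofSet (X \ {x})) ∂Measure.count := by
        rw [lintegral_singleton, Measure.count_singleton, mul_one, hval]
    _ ≤ _ := lintegral_mono_set (singleton_subset_iff.2 hmem)

/-- With an open right end, any point with nonzero weight must be vertex `n + 1`, so at most one
term survives. -/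
lemma lintegral_vertexWeight_le {X : Set (ℝ × ℝ)} (hX : IsNice X) (b d c : ℝ → ℝ≥0∞) (n : ℕ) :
    ∫⁻ x in X, vertexWeight b d c Ioo n (x, Config.ofSet (X \ {x})) ∂Measure.count
      ≤ b (hullState X n).2.1 * d (hullState X (n + 1)).2.1 * c (hullState X (n + 1)).1 := by
  set v := b (hullState X n).2.1 * d (hullState X (n + 1)).2.1 * c (hullState X (n + 1)).1 with hv
  calc ∫⁻ x in X, vertexWeight b d c Ioo n (x, Config.ofSet (X \ {x})) ∂Measure.count
      ≤ ∫⁻ x in X, ({(hullState X (n + 1)).2} : Set (ℝ × ℝ)).indicator (fun _ => v) x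
          ∂Measure.count := by
        refine setLIntegral_mono' hX.countable.measurableSet fun x hx => ?_
        rw [vertexWeight]
        refine indicator_apply_le' (fun hmem => ?_) fun _ => zero_le
        obtain ⟨hy, ht, ht'⟩ := hmem
        have hz : hullState X n = hullState (Config.ofSet (X \ {x})) n :=
          hullState_of_diff_singleton hX hy ht le_rfl
        have hz' : hullState X (n + 1) =
            (levelTime (hullState (Config.ofSet (X \ {x})) n).2 x, x) :=
          hullState_succ_of_diff_singleton hX hx hy ht ht'
        rw [indicator_of_mem (by rw [hz']; rfl), hv, hz', hz]
    _ ≤ ∫⁻ x, ({(hullState X (n + 1)).2} : Set (ℝ × ℝ)).indicator (fun _ => v) x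
          ∂Measure.count := setLIntegral_le_lintegral _ _
    _ = v := by
        rw [lintegral_indicator (measurableSet_singleton _), lintegral_singleton,
          Measure.count_singleton, mul_one]

/-- The one-step formula for the successive states. -/
theorem lintegral_step {Ω : Type*} [MeasurableSpace Ω] {P : Measure Ω} [IsProbabilityMeasure P]
    {X : Ω → Set (ℝ × ℝ)} (h : IsPoissonProcess quadrantIntensity X P)
    (hnice : ∀ᵐ ω ∂P, IsNice (X ω)) {b d c : ℝ → ℝ≥0∞} (hb : Measurable b) (hd : Measurable d)
    (hc : Measurable c) (n : ℕ) :
    ∫⁻ ω, b (hullState (X ω) n).2.1 * d (hullState (X ω) (n + 1)).2.1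
        * c (hullState (X ω) (n + 1)).1 ∂P
      = ∫⁻ ω, b (hullState (X ω) n).2.1 * jumpIntegral d (hullState (X ω) n).2.1
          * (∫⁻ t in Ioo (hullState (X ω) n).1 (hullState (X ω) (n + 1)).1, c t) ∂P := by
  -- The right end of the interval is a null set, so the upper and lower bounds have the same Mecke
  -- integral and ties never need to be excluded.
  have key : ∀ {I : ℝ → ℝ → Set ℝ}, MeasurableSet {w : ℝ × ℝ × ℝ | w.1 ∈ I w.2.1 w.2.2} →
      (∀ s t, MeasurableSet (I s t)) → (∀ s t, I s t ⊆ Ioi s) →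
      (∀ s t, (I s t : Set ℝ) =ᵐ[volume] Ioo s t) →
      ∫⁻ ω, ∫⁻ x in X ω, vertexWeight b d c I n (x, Config.ofSet (X ω \ {x}))
        ∂Measure.count ∂P
      = ∫⁻ ω, b (hullState (X ω) n).2.1 * jumpIntegral d (hullState (X ω) n).2.1
          * (∫⁻ t in Ioo (hullState (X ω) n).1 (hullState (X ω) (n + 1)).1, c t) ∂P := by
    intro I hI hIm hIs hIae
    rw [h.lintegral_mecke (measurable_vertexWeight hb hd hc hI n)]
    refine lintegral_congr_ae ?_
    filter_upwards [hnice] with ω hω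
    have hv := isValid_hullState hω n
    have hv0 : 0 ≤ (hullState (X ω) n).2.2 := (hω.pos _ hv.1.mem).2.le
    rw [← setLIntegral_congr (hIae _ _)]
    exact lintegral_quadrant (b := b) hd hc (hIm _ (hullState (X ω) (n + 1)).1)
      (fun t ht => (zero_le_one.trans hv.2).trans_lt (hIs _ _ ht)) _ hv0
  refine le_antisymm ?_ ?_
  · rw [← key (I := Ioc) ((measurableSet_lt measurable_snd.fst measurable_fst).inter
      (measurableSet_le measurable_fst measurable_snd.snd)) (fun _ _ => measurableSet_Ioc)
      (fun _ _ _ hx => hx.1) (fun _ _ => Ioo_ae_eq_Ioc.symm)]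
    refine lintegral_mono_ae ?_
    filter_upwards [hnice] with ω hω
    exact le_lintegral_vertexWeight hω b d c n
  · rw [← key (I := Ioo) ((measurableSet_lt measurable_snd.fst measurable_fst).inter
      (measurableSet_lt measurable_fst measurable_snd.snd)) (fun _ _ => measurableSet_Ioo)
      (fun _ _ _ hx => hx.1) (fun _ _ => Filter.EventuallyEq.rfl)]
    refine lintegral_mono_ae ?_
    filter_upwards [hnice] with ω hω
    exact lintegral_vertexWeight_le hω b d c n

/-! ### Moment recursions and geometric decay -/

section Moments

/-- An absolute bound for the third moment of the first intercept. -/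
def thirdMomentBound : ℝ := ∑' k : ℕ, ((k : ℝ) + 1) ^ 3 * Real.exp (2 - k)

lemma summable_thirdMomentBound :
    Summable fun k : ℕ => ((k : ℝ) + 1) ^ 3 * Real.exp (2 - k) := by
  have h := (summable_nat_add_iff 1).2 (Real.summable_pow_mul_exp_neg_nat_mul 3 one_pos)
  refine (h.mul_left (Real.exp 3)).congr fun k => ?_
  push_cast
  rw [mul_left_comm, ← Real.exp_add]
  congr 2
  ring

lemma thirdMomentBound_nonneg : 0 ≤ thirdMomentBound :=
  tsum_nonneg fun k => by positivity

lemma quadrantIntensity_rectangle {r s : ℝ} (hr : 0 ≤ r) :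
    quadrantIntensity (Ioo 0 r ×ˢ Ioo 0 s) = ENNReal.ofReal (r * s / 2) := by
  have hsub : Ioo 0 r ×ˢ Ioo 0 s ⊆ (Ioi 0 ×ˢ Ioi 0 : Set (ℝ × ℝ)) :=
    prod_mono Ioo_subset_Ioi_self Ioo_subset_Ioi_self
  have h6 : (2 : ℝ≥0∞)⁻¹ = ENNReal.ofReal (1 / 2) := by
    rw [one_div, ENNReal.ofReal_inv_of_pos two_pos]; simp
  rw [quadrantIntensity, Measure.restrict_apply (measurableSet_Ioo.prod measurableSet_Ioo),
    inter_eq_left.2 hsub, Measure.smul_apply, Measure.volume_eq_prod, Measure.prod_prod,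
    Real.volume_Ioo, Real.volume_Ioo, smul_eq_mul, h6, sub_zero, sub_zero, ← ENNReal.ofReal_mul hr,
    ← ENNReal.ofReal_mul (by positivity)]
  congr 1
  ring

variable {Ω : Type*} [MeasurableSpace Ω] {P : Measure Ω}
  {X : Ω → Set (ℝ × ℝ)}

lemma measurable_hullState_comp (h : IsPoissonProcess quadrantIntensity X P) (n : ℕ) :
    Measurable fun ω => hullState (X ω) n :=
  (measurable_hullState n).comp h.measurable_config

/-- At time `1` the sum `Y₀ + M₀` is minimal. If `Y₀ ≥ k`, the square of side `k / 2` at the origin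
contains no point, an event of probability `exp (-k² / 8)`. -/
lemma measure_le_intercept (h : IsPoissonProcess quadrantIntensity X P)
    (hnice : ∀ᵐ ω ∂P, IsNice (X ω)) (k : ℕ) :
    P {ω | (k : ℝ) ≤ (hullState (X ω) 0).2.1} ≤ ENNReal.ofReal (Real.exp (2 - k)) := by
  have hk : (0 : ℝ) ≤ (k : ℝ) / 2 := by positivity
  have hsq := quadrantIntensity_rectangle (s := (k : ℝ) / 2) hk
  have hvoid := h.measure_void (A := Ioo 0 ((k : ℝ) / 2) ×ˢ Ioo 0 ((k : ℝ) / 2))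
    (measurableSet_Ioo.prod measurableSet_Ioo) (by rw [hsq]; exact ENNReal.ofReal_ne_top)
  calc P {ω | (k : ℝ) ≤ (hullState (X ω) 0).2.1}
      ≤ P {ω | X ω ∩ Ioo 0 ((k : ℝ) / 2) ×ˢ Ioo 0 ((k : ℝ) / 2) = ∅} := by
        refine measure_mono_ae ?_
        filter_upwards [hnice] with ω hω hle
        refine eq_empty_of_forall_notMem fun x hx => ?_
        have hv := (isValid_hullState hω 0).1
        have h1 := hv.le x hx.1
        have h2 := (hω.pos _ hv.mem).2
        have h3 : (hullState (X ω) 0).1 = 1 := rfl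
        have h4 : (k : ℝ) ≤ (hullState (X ω) 0).2.1 := hle
        have h5 := hx.2.1.2
        have h6 := hx.2.2.2
        rw [h3] at h1
        linarith
    _ = ENNReal.ofReal (Real.exp (-((k : ℝ) / 2 * ((k : ℝ) / 2) / 2))) := by
        rw [hvoid, hsq, ENNReal.toReal_ofReal (by positivity)]
    _ ≤ ENNReal.ofReal (Real.exp (2 - k)) := by
        refine ENNReal.ofReal_le_ofReal (Real.exp_le_exp.2 ?_)
        -- `k² / 8 - k + 2 = (k - 4)² / 8`.
        nlinarith [sq_nonneg ((k : ℝ) - 4)]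

lemma lintegral_intercept_zero_pow_three [IsProbabilityMeasure P]
    (h : IsPoissonProcess quadrantIntensity X P)
    (hnice : ∀ᵐ ω ∂P, IsNice (X ω)) :
    ∫⁻ ω, ENNReal.ofReal ((hullState (X ω) 0).2.1 ^ 3) ∂P
      ≤ ENNReal.ofReal thirdMomentBound := by
  have hm := (measurable_hullState_comp h 0).snd.fst
  have hS : ∀ k : ℕ, MeasurableSet {ω | (k : ℝ) ≤ (hullState (X ω) 0).2.1} := fun k =>
    measurableSet_le measurable_const hm
  calc ∫⁻ ω, ENNReal.ofReal ((hullState (X ω) 0).2.1 ^ 3) ∂P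
      ≤ ∫⁻ ω, ∑' k : ℕ, {ω | (k : ℝ) ≤ (hullState (X ω) 0).2.1}.indicator
          (fun _ => ENNReal.ofReal (((k : ℝ) + 1) ^ 3)) ω ∂P := by
        refine lintegral_mono_ae ?_
        filter_upwards [hnice] with ω hω
        have h0 := (hω.pos _ (isValid_hullState hω 0).1.mem).1.le
        refine le_trans ?_ (ENNReal.le_tsum ⌊(hullState (X ω) 0).2.1⌋₊)
        rw [indicator_of_mem (by exact Nat.floor_le h0)]
        exact ENNReal.ofReal_le_ofReal (pow_le_pow_left₀ h0 (Nat.lt_floor_add_one _).le 3)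
    _ = ∑' k : ℕ, ENNReal.ofReal (((k : ℝ) + 1) ^ 3)
          * P {ω | (k : ℝ) ≤ (hullState (X ω) 0).2.1} := by
        rw [lintegral_tsum fun k => (measurable_const.indicator (hS k)).aemeasurable]
        refine tsum_congr fun k => ?_
        rw [lintegral_indicator_const (hS k)]
    _ ≤ ∑' k : ℕ, ENNReal.ofReal (((k : ℝ) + 1) ^ 3 * Real.exp (2 - k)) := by
        refine ENNReal.tsum_le_tsum fun k => ?_
        rw [ENNReal.ofReal_mul (by positivity)]
        gcongr
        exact measure_le_intercept h hnice k
    _ = ENNReal.ofReal thirdMomentBound :=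
        (ENNReal.ofReal_tsum_of_nonneg (fun k => by positivity) summable_thirdMomentBound).symm

/-- The ratio of successive intercepts has `k`-th moment `2 / ((k + 1) (k + 2))`, and is
independent of the time of the change. -/
lemma lintegral_intercept_succ_pow [IsProbabilityMeasure P]
    (h : IsPoissonProcess quadrantIntensity X P)
    (hnice : ∀ᵐ ω ∂P, IsNice (X ω)) {c : ℝ → ℝ≥0∞} (hc : Measurable c) (n k : ℕ) :
    ∫⁻ ω, ENNReal.ofReal ((hullState (X ω) (n + 1)).2.1 ^ k) * c (hullState (X ω) (n + 1)).1 ∂P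
      = ENNReal.ofReal (2 / ((k + 1) * (k + 2))) *
        ∫⁻ ω, ENNReal.ofReal ((hullState (X ω) n).2.1 ^ k) * c (hullState (X ω) (n + 1)).1 ∂P := by
  have hpow : Measurable fun y : ℝ => ENNReal.ofReal (y ^ k) := by fun_prop
  -- Putting the power on `Yₙ₊₁` or on `Yₙ` yields the same integral of `Yₙ ^ (k + 2)`, with
  -- constants `1 / (2 (k + 1) (k + 2))` and `1 / 4`.
  have h1 := lintegral_step h hnice (measurable_const (a := 1)) hpow hc n
  have h2 := lintegral_step h hnice hpow (measurable_const (a := 1)) hc n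
  simp only [one_mul, mul_one] at h1 h2
  rw [h1, h2, ← lintegral_const_mul' _ _ ENNReal.ofReal_ne_top]
  refine lintegral_congr_ae ?_
  filter_upwards [hnice] with ω hω
  have h0 := (hω.pos _ (isValid_hullState hω n).1.mem).1.le
  have h3 := jumpIntegral_pow 0 h0
  simp only [pow_zero, ENNReal.ofReal_one] at h3
  rw [jumpIntegral_pow k h0, h3, ← mul_assoc, ← mul_assoc, ← ENNReal.ofReal_mul (by positivity),
    ← ENNReal.ofReal_mul (by positivity)]
  congr 2
  push_cast
  field_simp
  ring

/-- Take `b(y) = y` and `c = d = 1` in the one-step identity: the time integral becomes `Tₙ₊₁ - Tₙ`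
and `jumpIntegral` becomes `Yₙ² / 4`. -/
lemma lintegral_intercept_time_diff [IsProbabilityMeasure P]
    (h : IsPoissonProcess quadrantIntensity X P)
    (hnice : ∀ᵐ ω ∂P, IsNice (X ω)) (n : ℕ) :
    ∫⁻ ω, ENNReal.ofReal ((hullState (X ω) n).2.1 ^ 3 *
        ((hullState (X ω) (n + 1)).1 - (hullState (X ω) n).1)) ∂P
      = ENNReal.ofReal 4 * ∫⁻ ω, ENNReal.ofReal (hullState (X ω) n).2.1 ∂P := by
  have h1 := lintegral_step h hnice ENNReal.measurable_ofReal (measurable_const (a := 1))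
    (measurable_const (a := 1)) n
  simp only [mul_one, lintegral_const, Measure.restrict_apply_univ, one_mul, Real.volume_Ioo] at h1
  rw [h1, ← lintegral_const_mul' _ _ ENNReal.ofReal_ne_top]
  refine lintegral_congr_ae ?_
  filter_upwards [hnice] with ω hω
  have h0 := (hω.pos _ (isValid_hullState hω n).1.mem).1.le
  have h3 := jumpIntegral_pow 0 h0
  simp only [pow_zero, ENNReal.ofReal_one] at h3
  rw [h3, ← mul_assoc, ← ENNReal.ofReal_mul h0, ← ENNReal.ofReal_mul (by positivity),
    ← ENNReal.ofReal_mul (by positivity)]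
  congr 1
  push_cast
  ring

lemma lintegral_intercept_succ [IsProbabilityMeasure P]
    (h : IsPoissonProcess quadrantIntensity X P)
    (hnice : ∀ᵐ ω ∂P, IsNice (X ω)) (n : ℕ) :
    ∫⁻ ω, ENNReal.ofReal (hullState (X ω) (n + 1)).2.1 ∂P
      = ENNReal.ofReal (1 / 3) * ∫⁻ ω, ENNReal.ofReal (hullState (X ω) n).2.1 ∂P := by
  have := lintegral_intercept_succ_pow h hnice (measurable_const (a := 1)) n 1
  simp only [pow_one, mul_one] at this
  rw [this]
  norm_num

/-- The factor `1/10` is the case `k = 3`, weighted by `Tₙ₊₁`. Then `Tₙ₊₁` is split as `Tₙ + (Tₙ₊₁ -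
Tₙ)`. -/
lemma lintegral_quotient_succ [IsProbabilityMeasure P]
    (h : IsPoissonProcess quadrantIntensity X P)
    (hnice : ∀ᵐ ω ∂P, IsNice (X ω)) (n : ℕ) :
    ∫⁻ ω, ENNReal.ofReal ((hullState (X ω) (n + 1)).2.1 ^ 3 * (hullState (X ω) (n + 1)).1) ∂P
      = ENNReal.ofReal (1 / 10) *
        (∫⁻ ω, ENNReal.ofReal ((hullState (X ω) n).2.1 ^ 3 * (hullState (X ω) n).1) ∂P
          + ENNReal.ofReal 4 * ∫⁻ ω, ENNReal.ofReal (hullState (X ω) n).2.1 ∂P) := by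
  have hm := measurable_hullState_comp h n
  have h1 := lintegral_intercept_succ_pow h hnice ENNReal.measurable_ofReal n 3
  have e1 : ∫⁻ ω, ENNReal.ofReal ((hullState (X ω) (n + 1)).2.1 ^ 3 *
      (hullState (X ω) (n + 1)).1) ∂P = ∫⁻ ω, ENNReal.ofReal ((hullState (X ω) (n + 1)).2.1 ^ 3) *
      ENNReal.ofReal (hullState (X ω) (n + 1)).1 ∂P := by
    refine lintegral_congr_ae ?_
    filter_upwards [hnice] with ω hω
    have h0 := (hω.pos _ (isValid_hullState hω (n + 1)).1.mem).1.le
    rw [ENNReal.ofReal_mul (by positivity)]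
  rw [e1, h1, ← lintegral_intercept_time_diff h hnice n, ← lintegral_add_left (by fun_prop)]
  congr 1
  · norm_num
  · refine lintegral_congr_ae ?_
    filter_upwards [hnice] with ω hω
    have hv := isValid_hullState hω n
    have h0 := (hω.pos _ hv.1.mem).1.le
    have h2 := (isStep_hullState hω n).time_lt
    rw [← ENNReal.ofReal_mul (by positivity), ← ENNReal.ofReal_add]
    · congr 1
      ring
    · exact mul_nonneg (by positivity) (zero_le_one.trans hv.2)
    · exact mul_nonneg (by positivity) (sub_nonneg.2 h2.le)

/-- The mean of `Yₙ ^ 3 * Tₙ` decays geometrically. -/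
theorem lintegral_quotient_le [IsProbabilityMeasure P]
    (h : IsPoissonProcess quadrantIntensity X P)
    (hnice : ∀ᵐ ω ∂P, IsNice (X ω)) (n : ℕ) :
    ∫⁻ ω, ENNReal.ofReal ((hullState (X ω) n).2.1 ^ 3 * (hullState (X ω) n).1) ∂P
      ≤ ENNReal.ofReal (2 * (1 + thirdMomentBound) * (3 : ℝ)⁻¹ ^ n) := by
  have hD := thirdMomentBound_nonneg
  have h3 := lintegral_intercept_zero_pow_three h hnice
  have he : ∀ n : ℕ, ∫⁻ ω, ENNReal.ofReal (hullState (X ω) n).2.1 ∂P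
      ≤ ENNReal.ofReal ((1 + thirdMomentBound) * (3 : ℝ)⁻¹ ^ n) := by
    intro n
    induction n with
    | zero =>
      calc ∫⁻ ω, ENNReal.ofReal (hullState (X ω) 0).2.1 ∂P
          ≤ ∫⁻ ω, (1 + ENNReal.ofReal ((hullState (X ω) 0).2.1 ^ 3)) ∂P := by
            refine lintegral_mono_ae ?_
            filter_upwards [hnice] with ω hω
            have h0 := (hω.pos _ (isValid_hullState hω 0).1.mem).1.le
            rw [← ENNReal.ofReal_one, ← ENNReal.ofReal_add zero_le_one (by positivity)]
            refine ENNReal.ofReal_le_ofReal ?_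
            set y := (hullState (X ω) 0).2.1
            -- `y ≤ 1 + y³` for `y ≥ 0`, so the third moment also controls the first.
            nlinarith [mul_nonneg h0 (sq_nonneg (y - 1)), sq_nonneg (y - 1)]
        _ ≤ 1 + ENNReal.ofReal thirdMomentBound := by
            rw [lintegral_add_left measurable_const]
            simp only [lintegral_const, measure_univ, mul_one]
            gcongr
        _ = _ := by
            rw [pow_zero, mul_one, ENNReal.ofReal_add zero_le_one hD, ENNReal.ofReal_one]
    | succ n ih =>
      rw [lintegral_intercept_succ h hnice n]
      refine (mul_le_mul_right ih _).trans ?_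
      rw [← ENNReal.ofReal_mul (by norm_num)]
      refine ENNReal.ofReal_le_ofReal (le_of_eq ?_)
      rw [pow_succ]
      ring
  induction n with
  | zero =>
    refine le_trans (le_of_eq ?_) (h3.trans (ENNReal.ofReal_le_ofReal ?_))
    · refine lintegral_congr fun ω => ?_
      have : (hullState (X ω) 0).1 = 1 := rfl
      rw [this, mul_one]
    · rw [pow_zero]
      linarith
  | succ n ih =>
    rw [lintegral_quotient_succ h hnice n]
    refine (mul_le_mul_right (add_le_add ih (mul_le_mul_right (he n) _)) _).trans ?_
    rw [← ENNReal.ofReal_mul (by norm_num), ← ENNReal.ofReal_add (by positivity) (by positivity),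
      ← ENNReal.ofReal_mul (by norm_num)]
    refine ENNReal.ofReal_le_ofReal ?_
    rw [pow_succ]
    have : 0 ≤ (1 + thirdMomentBound) * (3 : ℝ)⁻¹ ^ n := by positivity
    -- The induction closes because `(2 + 4) / 10 ≤ 2 / 3`; this is where the factor `2` in the
    -- bound is used.
    linarith

end Moments

/-! ### From lines to points of the quadrant -/

/-- The intercept on the `y`-axis and the slope of a line. -/
def lineCoord : Line →ₗ[ℝ] ℝ × ℝ where
  toFun l := ((l.1 + l.2) / 2, (l.2 - l.1) / 2)
  map_add' l l' := by ext <;> simp <;> ring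
  map_smul' c l := by ext <;> simp <;> ring

lemma lineCoord_injective : Function.Injective lineCoord := by
  intro l l' h
  have h1 : (l.1 + l.2) / 2 = (l'.1 + l'.2) / 2 := congrArg Prod.fst h
  have h2 : (l.2 - l.1) / 2 = (l'.2 - l'.1) / 2 := congrArg Prod.snd h
  exact Prod.ext (by linarith) (by linarith)

lemma height_eq (l : Line) (s : ℝ) : height l s = (lineCoord l).1 + s * (lineCoord l).2 := by
  change (1 - s) / 2 * l.1 + (1 + s) / 2 * l.2 = (l.1 + l.2) / 2 + s * ((l.2 - l.1) / 2)
  ring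

lemma measurable_lineCoord : Measurable lineCoord := by
  change Measurable fun l : Line => ((l.1 + l.2) / 2, (l.2 - l.1) / 2)
  fun_prop

lemma det_lineCoord : LinearMap.det lineCoord = 1 / 2 := by
  rw [← LinearMap.det_toMatrix (Module.Basis.finTwoProd ℝ), Matrix.det_fin_two]
  simp [LinearMap.toMatrix_apply, lineCoord]
  norm_num

lemma map_lineCoord : improperIntensity.map lineCoord
    = (2 : ℝ≥0∞)⁻¹ • (volume : Measure (ℝ × ℝ)) := by
  have hdet : LinearMap.det lineCoord ≠ 0 := by rw [det_lineCoord]; norm_num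
  rw [improperIntensity, Measure.map_smul,
    Measure.map_linearMap_addHaar_eq_smul_addHaar volume hdet, det_lineCoord, smul_smul]
  congr 1
  rw [show |((1 : ℝ) / 2)⁻¹| = 2 by norm_num]
  rw [show (4 : ℝ≥0∞) = 2 * 2 by norm_num, ENNReal.mul_inv (by simp) (by simp), mul_assoc]
  rw [show ENNReal.ofReal 2 = 2 by simp, ENNReal.inv_mul_cancel (by simp) (by simp), mul_one]

/-- A line of intercept `y` and slope `m > 0` meets the `x`-axis at `-y / m`, which is negative
exactly when `y > 0`. -/
lemma positiveLines_eq (L : Set Line) :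
    positiveLines L = {l ∈ L | lineCoord l ∈ (Ioi 0 ×ˢ Ioi 0 : Set (ℝ × ℝ))} := by
  ext l
  refine and_congr_right fun _ => ?_
  have hs : slope l = (lineCoord l).2 := rfl
  rw [hs]
  constructor
  · rintro ⟨hpos, x, hx, h0⟩
    rw [height_eq] at h0
    exact ⟨by change 0 < (lineCoord l).1; nlinarith, hpos⟩
  · rintro ⟨h1, h2⟩
    have h1 : 0 < (lineCoord l).1 := h1
    have h2 : 0 < (lineCoord l).2 := h2
    refine ⟨h2, -((lineCoord l).1 / (lineCoord l).2), neg_neg_of_pos (div_pos h1 h2), ?_⟩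
    rw [height_eq]
    field_simp
    ring

/-- The points of the positive quadrant that represent the lines of `positiveLines L`. -/
def pointSet (L : Set Line) : Set (ℝ × ℝ) := lineCoord '' positiveLines L

lemma pointSet_inter (L : Set Line) (A : Set (ℝ × ℝ)) :
    pointSet L ∩ A = lineCoord '' (L ∩ lineCoord ⁻¹' (A ∩ Ioi 0 ×ˢ Ioi 0)) := by
  rw [pointSet, positiveLines_eq, ← image_inter_preimage]
  congr 1
  ext l
  simp only [mem_inter_iff, mem_ofPred_eq, mem_preimage]
  tauto

lemma encard_pointSet_inter (L : Set Line) (A : Set (ℝ × ℝ)) :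
    (pointSet L ∩ A).encard = (L ∩ lineCoord ⁻¹' (A ∩ Ioi 0 ×ˢ Ioi 0)).encard := by
  rw [pointSet_inter, lineCoord_injective.encard_image]

/-- The coordinate map is injective, so counts of points are counts of lines over preimages. Its
determinant `1/2` turns the density `1/4` into `1/2`. -/
lemma isPoissonProcess_pointSet {Ω : Type*} [MeasurableSpace Ω] {P : Measure Ω}
    {L : Ω → Set Line} (h : IsPoissonProcess improperIntensity L P) :
    IsPoissonProcess quadrantIntensity (fun ω => pointSet (L ω)) P := by
  have hQ : MeasurableSet (Ioi 0 ×ˢ Ioi 0 : Set (ℝ × ℝ)) := measurableSet_Ioi.prod measurableSet_Ioi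
  have hm : ∀ {A : Set (ℝ × ℝ)}, MeasurableSet A →
      MeasurableSet (lineCoord ⁻¹' (A ∩ Ioi 0 ×ˢ Ioi 0)) := fun hA =>
    measurable_lineCoord (hA.inter hQ)
  have hν : ∀ {A : Set (ℝ × ℝ)}, MeasurableSet A →
      improperIntensity (lineCoord ⁻¹' (A ∩ Ioi 0 ×ˢ Ioi 0)) = quadrantIntensity A := by
    intro A hA
    rw [← Measure.map_apply measurable_lineCoord (hA.inter hQ), map_lineCoord, quadrantIntensity,
      Measure.restrict_apply hA]
  refine ⟨fun A hA => ?_, fun A hA hfin k => ?_, fun m A hA hdisj => ?_⟩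
  · simp_rw [encard_pointSet_inter]
    exact h.measurable_count _ (hm hA)
  · simp_rw [encard_pointSet_inter]
    rw [h.law_count _ (hm hA) (by rwa [hν hA]), hν hA]
  · simp_rw [encard_pointSet_inter]
    refine h.indep_count m _ (fun i => hm (hA i)) fun i j hij => ?_
    exact ((hdisj hij).mono inter_subset_left inter_subset_left).preimage _

lemma ae_isNice {Ω : Type*} [MeasurableSpace Ω] {P : Measure Ω} [IsProbabilityMeasure P]
    {L : Ω → Set Line} (h : IsPoissonProcess improperIntensity L P) :
    ∀ᵐ ω ∂P, IsNice (pointSet (L ω)) := by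
  have hX := isPoissonProcess_pointSet h
  have hpos : ∀ ω, ∀ p ∈ pointSet (L ω), 0 < p.1 ∧ 0 < p.2 := by
    rintro ω _ ⟨l, hl, rfl⟩
    rw [positiveLines_eq] at hl
    exact hl.2
  have hR : ∀ r s : ℝ, MeasurableSet (Ioo 0 r ×ˢ Ioo 0 s : Set (ℝ × ℝ)) := fun r s =>
    measurableSet_Ioo.prod measurableSet_Ioo
  have hfin : ∀ᵐ ω ∂P, ∀ k : ℕ, (pointSet (L ω) ∩ Ioo 0 (k : ℝ) ×ˢ Ioo 0 (k : ℝ)).Finite := by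
    refine ae_all_iff.2 fun k => hX.ae_finite (hR _ _) ?_
    rw [quadrantIntensity_rectangle (Nat.cast_nonneg k)]
    exact ENNReal.ofReal_ne_top
  have hsmall : ∀ᵐ ω ∂P, ∀ j : ℕ, ∃ p ∈ pointSet (L ω), p.1 < 1 / ((j : ℝ) + 1) := by
    refine ae_all_iff.2 fun j => ?_
    have hε : (0 : ℝ) < 1 / ((j : ℝ) + 1) := by positivity
    set ε : ℝ := 1 / ((j : ℝ) + 1)
    rw [ae_iff]
    -- The strip `y < ε` has infinite intensity: its truncations at height `K` have intensity `ε K /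
    -- 2`, and are empty with probability tending to `0`.
    have hbound : ∀ K : ℕ, P {ω | ¬ ∃ p ∈ pointSet (L ω), p.1 < ε}
        ≤ ENNReal.ofReal (Real.exp (-(ε * K / 2))) := by
      intro K
      have hsq := quadrantIntensity_rectangle (s := (K : ℝ)) hε.le
      have hvoid := hX.measure_void (hR ε K) (by rw [hsq]; exact ENNReal.ofReal_ne_top)
      rw [hsq, ENNReal.toReal_ofReal (by positivity)] at hvoid
      rw [← hvoid]
      refine measure_mono fun ω hω => ?_
      refine eq_empty_of_forall_notMem fun p hp => hω ⟨p, hp.1, hp.2.1.2⟩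
    have hlim : Filter.Tendsto (fun K : ℕ => ENNReal.ofReal (Real.exp (-(ε * K / 2))))
        Filter.atTop (𝓝 0) := by
      rw [← ENNReal.ofReal_zero]
      refine ENNReal.tendsto_ofReal (Real.tendsto_exp_neg_atTop_nhds_zero.comp ?_)
      refine Filter.Tendsto.atTop_div_const two_pos ?_
      exact tendsto_natCast_atTop_atTop.const_mul_atTop hε
    exact le_antisymm (ge_of_tendsto' hlim hbound) zero_le
  filter_upwards [hfin, hsmall] with ω hω1 hω2
  refine ⟨hpos ω, fun c => ?_, fun ε hε => ?_⟩
  · obtain ⟨k, hk⟩ := exists_nat_gt c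
    refine (hω1 k).subset fun p hp => ?_
    have h1 := hpos ω p hp.1
    have h2 : p.1 + p.2 ≤ c := hp.2
    exact ⟨hp.1, ⟨h1.1, by linarith⟩, ⟨h1.2, by linarith⟩⟩
  · obtain ⟨j, hj⟩ := exists_nat_one_div_lt hε
    obtain ⟨p, hp, hlt⟩ := hω2 j
    exact ⟨p, hp, hlt.trans hj⟩

/-! ### The seminal curve read off the walk -/

section Envelope

variable {L : Set Line}

lemma seminalCurve_eq (hX : IsNice (pointSet L)) {n : ℕ} {s : ℝ}
    (h1 : (hullState (pointSet L) (n + 1)).1⁻¹ ≤ s) (h2 : s ≤ (hullState (pointSet L) n).1⁻¹) :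
    seminalCurve L s = (hullState (pointSet L) n).2.1 + s * (hullState (pointSet L) n).2.2 := by
  have hv := isValid_hullState hX n
  have hv' := isValid_hullState hX (n + 1)
  have hs := isStep_hullState hX n
  set z := hullState (pointSet L) n
  set z' := hullState (pointSet L) (n + 1)
  have hT : 0 < z.1 := zero_lt_one.trans_le hv.2
  have hT' : 0 < z'.1 := zero_lt_one.trans_le hv'.2
  have hs0 : 0 < s := (inv_pos.2 hT').trans_le h1
  have h1 : 1 ≤ s * z'.1 := (inv_le_iff_one_le_mul₀ hT').1 h1
  have h2 : s * z.1 ≤ 1 := (le_inv_mul_iff₀' hT).1 (by simpa using h2)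
  have himg : (fun l => height l s) '' positiveLines L
      = (fun p : ℝ × ℝ => p.1 + s * p.2) '' pointSet L := by
    rw [pointSet, image_image]
    exact image_congr fun l _ => height_eq l s
  rw [seminalCurve, himg]
  refine IsLeast.csInf_eq ⟨⟨z.2, hv.1.mem, rfl⟩, ?_⟩
  rintro _ ⟨p, hp, rfl⟩
  change z.2.1 + s * z.2.2 ≤ p.1 + s * p.2
  have h3 := mul_le_mul_of_nonneg_left (hv.1.le p hp) hs0.le
  have h4 := mul_le_mul_of_nonneg_left (hs.valid.le p hp) hs0.le
  rw [hs.line] at h4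
  -- With `t = 1 / s` between the two times, vertex `n` is minimal at both. Against points with
  -- larger `y` its minimality at `Tₙ` propagates forward; against points with smaller `y` its
  -- minimality at `Tₙ₊₁` propagates backward.
  rcases le_total z.2.1 p.1 with hle | hle
  · nlinarith [mul_nonneg (sub_nonneg.2 h2) (sub_nonneg.2 hle)]
  · nlinarith [mul_nonneg (sub_nonneg.2 h1) (sub_nonneg.2 hle)]

lemma inv_hullState_lt (hX : IsNice (pointSet L)) (n : ℕ) :
    0 < (hullState (pointSet L) (n + 1)).1⁻¹ ∧
      (hullState (pointSet L) (n + 1)).1⁻¹ < (hullState (pointSet L) n).1⁻¹ :=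
  ⟨inv_pos.2 (zero_lt_one.trans_le (isValid_hullState hX (n + 1)).2),
    inv_strictAnti₀ (zero_lt_one.trans_le (isValid_hullState hX n).2)
      (isStep_hullState hX n).time_lt⟩

lemma hasDerivAt_affine (a b s : ℝ) : HasDerivAt (fun s : ℝ => a + s * b) b s := by
  simpa using ((hasDerivAt_id s).mul_const b).const_add a

lemma hasDerivWithinAt_seminalCurve_left (hX : IsNice (pointSet L)) (n : ℕ) :
    HasDerivWithinAt (seminalCurve L) (hullState (pointSet L) n).2.2
      (Iio (hullState (pointSet L) n).1⁻¹) (hullState (pointSet L) n).1⁻¹ := by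
  have hlt := (inv_hullState_lt hX n).2
  have haff := hasDerivAt_affine (hullState (pointSet L) n).2.1
  refine (haff _ _).hasDerivWithinAt.congr_of_eventuallyEq
    ?_ (seminalCurve_eq hX hlt.le le_rfl)
  filter_upwards [Ioo_mem_nhdsLT hlt] with s hs
  exact seminalCurve_eq hX hs.1.le hs.2.le

lemma hasDerivWithinAt_seminalCurve_right (hX : IsNice (pointSet L)) (n : ℕ) :
    HasDerivWithinAt (seminalCurve L) (hullState (pointSet L) n).2.2
      (Ioi (hullState (pointSet L) (n + 1)).1⁻¹) (hullState (pointSet L) (n + 1)).1⁻¹ := by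
  have hlt := (inv_hullState_lt hX n).2
  have haff := hasDerivAt_affine (hullState (pointSet L) n).2.1
  refine (haff _ _).hasDerivWithinAt.congr_of_eventuallyEq
    ?_ (seminalCurve_eq hX le_rfl hlt.le)
  filter_upwards [Ioo_mem_nhdsGT hlt] with s hs
  exact seminalCurve_eq hX hs.1.le hs.2.le

/-- The curve is affine between consecutive change points. At the lower one its one-sided slopes are
`Mₙ₊₁` and `Mₙ`, which differ because the two vertices are level at a positive time with different
`y`. -/
lemma isGreatest_not_differentiableAt (hX : IsNice (pointSet L)) (n : ℕ) :
    IsGreatest {s ∈ Ioo 0 (hullState (pointSet L) n).1⁻¹ | ¬ DifferentiableAt ℝ (seminalCurve L) s}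
      (hullState (pointSet L) (n + 1)).1⁻¹ := by
  refine ⟨⟨inv_hullState_lt hX n, fun hdiff => ?_⟩, fun s hs => ?_⟩
  · have h := hdiff.hasDerivAt
    have hl := (uniqueDiffWithinAt_Iio _).eq_deriv _ (h.hasDerivWithinAt (s := Iio _))
      (hasDerivWithinAt_seminalCurve_left hX (n + 1))
    have hr := (uniqueDiffWithinAt_Ioi _).eq_deriv _ (h.hasDerivWithinAt (s := Ioi _))
      (hasDerivWithinAt_seminalCurve_right hX n)
    have hs := isStep_hullState hX n
    have hT := (zero_lt_one.trans_le (isValid_hullState hX (n + 1)).2)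
    have := hs.line
    rw [← hl, ← hr] at this
    nlinarith [mul_pos hT (sub_pos.2 hs.lt)]
  · by_contra! hlt
    refine hs.2 ((hasDerivAt_affine (hullState (pointSet L) n).2.1
      (hullState (pointSet L) n).2.2 s).congr_of_eventuallyEq ?_).differentiableAt
    filter_upwards [Ioo_mem_nhds hlt hs.1.2] with r hr
    exact seminalCurve_eq hX hr.1.le hr.2.le

lemma changeTime_eq (hX : IsNice (pointSet L)) (n : ℕ) :
    changeTime L n = (hullState (pointSet L) n).1⁻¹ := by
  induction n with
  | zero => exact (inv_one (G := ℝ)).symm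
  | succ n ih =>
    rw [changeTime, ih]
    exact (isGreatest_not_differentiableAt hX n).csSup_eq

lemma yIntercept_eq (hX : IsNice (pointSet L)) (n : ℕ) :
    yIntercept L n = (hullState (pointSet L) n).2.1 := by
  rw [yIntercept, seminalSlope, changeTime_eq hX,
    (hasDerivWithinAt_seminalCurve_left hX n).derivWithin (uniqueDiffWithinAt_Iio _),
    seminalCurve_eq hX (inv_hullState_lt hX n).2.le le_rfl]
  ring

lemma quotient_eq (hX : IsNice (pointSet L)) (n : ℕ) :
    yIntercept L n ^ 3 / changeTime L n
      = (hullState (pointSet L) n).2.1 ^ 3 * (hullState (pointSet L) n).1 := by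
  rw [yIntercept_eq hX, changeTime_eq hX, div_inv_eq_mul]

end Envelope

end PoissonCity

end

/-! ### Assembly of the result -/

theorem corollary4p5 :
    ∃ C : ℝ, ∀ (Ω : Type u) [MeasurableSpace Ω] (P : Measure Ω) [IsProbabilityMeasure P]
      (L : Ω → Set PoissonCity.Line),
      PoissonCity.IsPoissonProcess PoissonCity.improperIntensity L P →
      -- almost surely `1 = S₀ > S₁ > S₂ > … > 0` and `Yₙ > 0`, so the quotients are meaningful
      (∀ᵐ ω ∂P, StrictAnti (PoissonCity.changeTime (L ω)) ∧
        ∀ n, 0 < PoissonCity.changeTime (L ω) n ∧ 0 < PoissonCity.yIntercept (L ω) n) ∧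
      -- the mean decays geometrically
      (∀ n : ℕ,
        Integrable
          (fun ω => PoissonCity.yIntercept (L ω) n ^ 3 / PoissonCity.changeTime (L ω) n) P ∧
        ∫ ω, PoissonCity.yIntercept (L ω) n ^ 3 / PoissonCity.changeTime (L ω) n ∂P
          ≤ C * (3 : ℝ)⁻¹ ^ n) ∧
      -- almost sure geometric convergence to zero
      (∀ ρ : ℝ, 1 / 3 < ρ → ρ < 1 → ∀ᵐ ω ∂P, ∃ K : ℝ, ∀ n : ℕ,
        |PoissonCity.yIntercept (L ω) n ^ 3 / PoissonCity.changeTime (L ω) n| ≤ K * ρ ^ n) := by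
  refine ⟨2 * (1 + PoissonCity.thirdMomentBound), fun Ω _ P _ L hL => ?_⟩
  have hnice := PoissonCity.ae_isNice hL
  have hX := PoissonCity.isPoissonProcess_pointSet hL
  have hD := PoissonCity.thirdMomentBound_nonneg
  set g : ℕ → Ω → ℝ := fun n ω =>
    (PoissonCity.hullState (PoissonCity.pointSet (L ω)) n).2.1 ^ 3 *
      (PoissonCity.hullState (PoissonCity.pointSet (L ω)) n).1 with hg
  have hbound : ∀ n, ∫⁻ ω, ENNReal.ofReal (g n ω) ∂P
      ≤ ENNReal.ofReal (2 * (1 + PoissonCity.thirdMomentBound) * (3 : ℝ)⁻¹ ^ n) :=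
    PoissonCity.lintegral_quotient_le hX hnice
  have hgm : ∀ n, Measurable (g n) := fun n => by
    have := PoissonCity.measurable_hullState_comp hX n
    exact (this.snd.fst.pow_const 3).mul this.fst
  have hg0 : ∀ᵐ ω ∂P, ∀ n, 0 ≤ g n ω := by
    filter_upwards [hnice] with ω hω n
    have hv := PoissonCity.isValid_hullState hω n
    exact mul_nonneg (pow_nonneg (hω.pos _ hv.1.mem).1.le 3) (zero_le_one.trans hv.2)
  have heq : ∀ᵐ ω ∂P, ∀ n,
      PoissonCity.yIntercept (L ω) n ^ 3 / PoissonCity.changeTime (L ω) n = g n ω := by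
    filter_upwards [hnice] with ω hω n
    exact PoissonCity.quotient_eq hω n
  refine ⟨?_, fun n => ?_, fun ρ hρ _ => ?_⟩
  · filter_upwards [hnice] with ω hω
    refine ⟨strictAnti_nat_of_succ_lt fun n => ?_, fun n => ⟨?_, ?_⟩⟩
    · rw [PoissonCity.changeTime_eq hω, PoissonCity.changeTime_eq hω]
      exact (PoissonCity.inv_hullState_lt hω n).2
    · rw [PoissonCity.changeTime_eq hω]
      exact inv_pos.2 (zero_lt_one.trans_le (PoissonCity.isValid_hullState hω n).2)
    · rw [PoissonCity.yIntercept_eq hω]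
      exact (hω.pos _ (PoissonCity.isValid_hullState hω n).1.mem).1
  · have hae : (fun ω => PoissonCity.yIntercept (L ω) n ^ 3 / PoissonCity.changeTime (L ω) n)
        =ᵐ[P] g n := heq.mono fun ω h => h n
    have hg0n : 0 ≤ᵐ[P] g n := hg0.mono fun ω h => h n
    have hint : Integrable (g n) P := by
      refine ⟨(hgm n).aestronglyMeasurable, ?_⟩
      rw [hasFiniteIntegral_iff_ofReal hg0n]
      exact (hbound n).trans_lt ENNReal.ofReal_lt_top
    refine ⟨hint.congr hae.symm, ?_⟩
    rw [integral_congr_ae hae,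
      integral_eq_lintegral_of_nonneg_ae hg0n (hgm n).aestronglyMeasurable]
    exact ENNReal.toReal_le_of_le_ofReal (by positivity) (hbound n)
  · have hρ0 : 0 < ρ := by linarith
    -- Since `ρ > 1/3`, the expected sum of `ρ⁻ⁿ Yₙ³ Tₙ` is dominated by a convergent geometric
    -- series. The sum is thus almost surely finite, and it serves as `K`.
    have hsum : ∫⁻ ω, ∑' n, ENNReal.ofReal (ρ⁻¹ ^ n * g n ω) ∂P ≠ ⊤ := by
      rw [lintegral_tsum fun n => (by fun_prop)]
      have hs : Summable fun n : ℕ =>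
          2 * (1 + PoissonCity.thirdMomentBound) * (ρ⁻¹ * 3⁻¹) ^ n := by
        refine (summable_geometric_of_lt_one (by positivity) ?_).mul_left _
        rw [← mul_inv, inv_lt_one₀ (by positivity)]
        linarith
      refine ne_top_of_le_ne_top (hs.tsum_ofReal_ne_top) (ENNReal.tsum_le_tsum fun n => ?_)
      have hρn : 0 ≤ ρ⁻¹ ^ n := by positivity
      simp_rw [ENNReal.ofReal_mul hρn]
      rw [lintegral_const_mul' _ _ ENNReal.ofReal_ne_top]
      refine (mul_le_mul_right (hbound n) _).trans ?_
      rw [← ENNReal.ofReal_mul hρn]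
      refine ENNReal.ofReal_le_ofReal (le_of_eq ?_)
      rw [mul_pow]
      ring
    have hlt := ae_lt_top (Measurable.tsum fun n => by fun_prop) hsum
    filter_upwards [hlt, hg0, heq] with ω hω h0 he
    refine ⟨(∑' n, ENNReal.ofReal (ρ⁻¹ ^ n * g n ω)).toReal, fun n => ?_⟩
    rw [he n, abs_of_nonneg (h0 n)]
    have h1 : ρ⁻¹ ^ n * g n ω ≤ (∑' n, ENNReal.ofReal (ρ⁻¹ ^ n * g n ω)).toReal :=
      (ENNReal.ofReal_le_iff_le_toReal hω.ne).1 (ENNReal.le_tsum n)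
    rw [inv_pow, inv_mul_le_iff₀ (by positivity)] at h1
    linarith
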